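/- Let $D\subset\{(t,x)\in\mathbb R^2: x\neq 0\}$ be a non-empty connected open set and let $I,J\subset\mathbb R$ be non-empty open intervals. A vector field with $C^\infty$ coefficients is called a Lie symmetry operator of a system of differential equations if its prolongation, applied to the equations of the system, vanishes at all jets that satisfy the system (infinitesimal invariance criterion). The maximal Lie invariance algebra of the system is the Lie algebra of all its Lie symmetry operators. (1) The maximal Lie invariance algebra of the equation $$v_t+\frac2x v_x-v_{xx}=0,\qquad (t,x)\in D,\ v\in J,\tag{P}$$ is $$\mathfrak t_0=\langle \partial_t,\ 2t\partial_t+x\partial_x,\ 4t^2\partial_t+4tx\partial_x-(x^2-2t)v\partial_v,\ v\partial_v,\ f\partial_v\rangle,$$ where $f=f(t,x)$ runs through the smooth solutions of (P) on $D$. (2) The linear heat equation $u_t=u_{xx}$ has the conservation law $D_t(xu)+D_x(u-xu_x)=0$ with the characteristic $x$, i.e. $D_t(xu)+D_x(u-xu_x)=x(u_t-u_{xx})$. The associated potential system $$v_x=xu,\qquad v_t=xu_x-u,\qquad (t,x)\in D,\ u\in I,\ v\in J,\tag{S}$$ has the maximal Lie invariance algebra $$\mathfrak t_1=\langle \partial_t,\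 2t\partial_t+x\partial_x-2u\partial_u,\ 4t^2\partial_t+4tx\partial_x-((x^2+6t)u+2v)\partial_u-(x^2-2t)v\partial_v,\ u\partial_u+v\partial_v,\ x^{-1}f_x\partial_u+f\partial_v\rangle,$$ where $f=f(t,x)$ again runs through the smooth solutions of (P) on $D$. (3) Consequently, this conservation law yields pure potential (genuinely nonlocal) symmetries of the linear heat equation: an operator $c_1Q_1+c_2Q_2+c_3Q_3+c_4Q_4+x^{-1}f_x\partial_u+f\partial_v$ of $\mathfrak t_1$, where $Q_1,\dots,Q_4$ are the first four listed operators, $c_1,\dots,c_4\in\mathbb R$ and $f$ is a smooth solution of (P) on $D$, is a pure potential symmetry operator if and only if $c_3\neq0$. Here a pure potential symmetry operator is a Lie symmetry operator of (S) for which at least one of the coefficients of $\partial_t$, $\partial_x$, $\partial_u$ depends on $v$. -/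

import Mathlib

open scoped ContDiff

noncomputable section

/-! ### Jets, total derivatives, prolongation

Two independent variables `t`, `x`; the dependent variables are indexed by `ι`. -/

/-- The space of independent and dependent variables, with points `(t, x, u)`. -/
abbrev Base (ι : Type) : Type := ℝ × ℝ × (ι → ℝ)

/-- The jet space: `(t, x, u)` together with all the derivatives;
`p.2.2 i j k` is the coordinate that stands for the derivative of `u^i`, taken
`j` times in `t` and `k` times in `x`. -/
abbrev Jet (ι : Type) : Type := ℝ × ℝ × (ι → ℕ → ℕ → ℝ)

/-- The projection of a jet to the space of variables. -/
def jetBase {ι : Type} (p : Jet ι) : Base ι := (p.1, p.2.1, fun i => p.2.2 i 0 0)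

/-- The total derivative `D_t F = F_t + ∑ u^i_{j+1,k} ∂F/∂u^i_{j,k}`, written as the derivative
of `F` in the direction `(1, 0, u^i_{j+1,k})`. -/
def totalT {ι : Type} (F : Jet ι → ℝ) (p : Jet ι) : ℝ :=
  lineDeriv ℝ F p (1, 0, fun i j k => p.2.2 i (j + 1) k)

/-- The total derivative `D_x F = F_x + ∑ u^i_{j,k+1} ∂F/∂u^i_{j,k}`. -/
def totalX {ι : Type} (F : Jet ι → ℝ) (p : Jet ι) : ℝ :=
  lineDeriv ℝ F p (0, 1, fun i j k => p.2.2 i j (k + 1))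

/-- The coefficients of the prolongation of `Q = τ ∂_t + ξ ∂_x + ∑ η^i ∂_{u^i}`, given by the usual
recursion: `η^{i,0} = η^i`, and
`η^{i,Jy} = D_y η^{i,J} - (D_y τ) u^i_{Jt} - (D_y ξ) u^i_{Jx}` for `y = t, x`.
A vector field is a map `Q : Base ι → Base ι`, with the value `(τ, ξ, η)`. -/
def prolongCoeff {ι : Type} (Q : Base ι → Base ι) (i : ι) : ℕ → ℕ → Jet ι → ℝ
  | 0, 0 => fun p => (Q (jetBase p)).2.2 i
  | j + 1, 0 => fun p =>
      totalT (prolongCoeff Q i j 0) p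
        - totalT (fun q => (Q (jetBase q)).1) p * p.2.2 i (j + 1) 0
        - totalT (fun q => (Q (jetBase q)).2.1) p * p.2.2 i j 1
  | j, k + 1 => fun p =>
      totalX (prolongCoeff Q i j k) p
        - totalX (fun q => (Q (jetBase q)).1) p * p.2.2 i (j + 1) k
        - totalX (fun q => (Q (jetBase q)).2.1) p * p.2.2 i j (k + 1)

/-- The prolongation of a vector field to the jet space. -/
def prolongation {ι : Type} (Q : Base ι → Base ι) (p : Jet ι) : Jet ι :=
  ((Q (jetBase p)).1, (Q (jetBase p)).2.1, fun i j k => prolongCoeff Q i j k p)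

/-! ### Lie symmetries -/

/-- `Q` is a Lie symmetry operator, on the open set `Ω`, of the system `L μ = 0` (`μ : κ`):
`Q` is a smooth vector field on `Ω` and its prolongation, applied to each `L μ`, vanishes at all
jets over `Ω` that satisfy the system (infinitesimal invariance criterion). -/
def IsLieSymmetryOperator {ι κ : Type} [Fintype ι] (Ω : Set (Base ι)) (L : κ → Jet ι → ℝ)
    (Q : Base ι → Base ι) : Prop :=
  ContDiffOn ℝ ∞ Q Ω ∧
    ∀ p : Jet ι, jetBase p ∈ Ω → (∀ μ, L μ p = 0) →
      ∀ μ, lineDeriv ℝ (L μ) p (prolongation Q p) = 0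

/-- The linear space `𝔱` of vector fields, restricted to `Ω`, is the maximal Lie invariance algebra
of the system `L`: it is closed under the Lie bracket, and it consists of exactly the
Lie symmetry operators of `L` on `Ω`. Vector fields that agree on `Ω` are identified. -/
def IsMaximalLieInvarianceAlgebra {ι κ : Type} [Fintype ι] (Ω : Set (Base ι))
    (L : κ → Jet ι → ℝ) (𝔱 : Submodule ℝ (Base ι → Base ι)) : Prop :=
  (∀ Q ∈ 𝔱, ∀ R ∈ 𝔱, ∃ S ∈ 𝔱, Set.EqOn (VectorField.lieBracket ℝ Q R) S Ω) ∧
    ∀ Q : Base ι → Base ι, IsLieSymmetryOperator Ω L Q ↔ ∃ R ∈ 𝔱, Set.EqOn Q R Ω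

/-! ### Solutions -/

/-- The partial derivative in `t` of a function of `(t, x)`. -/
def partialT (f : ℝ × ℝ → ℝ) (z : ℝ × ℝ) : ℝ := lineDeriv ℝ f z (1, 0)

/-- The partial derivative in `x` of a function of `(t, x)`. -/
def partialX (f : ℝ × ℝ → ℝ) (z : ℝ × ℝ) : ℝ := lineDeriv ℝ f z (0, 1)

/-- The jet at `z = (t, x)` of a function `f(t, x)`. -/
def jetOf (f : ℝ × ℝ → ℝ) (z : ℝ × ℝ) : Jet (Fin 1) :=
  (z.1, z.2, fun _ j k => (partialT^[j] (partialX^[k] f)) z)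

/-- `f` is a smooth solution of the equation `L = 0` on the open set `D`. -/
def IsSolutionOn (D : Set (ℝ × ℝ)) (L : Jet (Fin 1) → ℝ) (f : ℝ × ℝ → ℝ) : Prop :=
  ContDiffOn ℝ ∞ f D ∧ ∀ z ∈ D, L (jetOf f z) = 0

/-! ### Conservation laws, potential systems and potential symmetries -/

/-- `(T, X)` is a conserved vector of the equation `L = 0` for one unknown function, and
its characteristic is `lam`: `D_t T + D_x X = lam L`. -/
def HasCharacteristic (L T X lam : Jet (Fin 1) → ℝ) : Prop :=
  ∀ p, totalT T p + totalX X p = lam p * L p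

/-- The `u`-part of a jet of the pair `(u, v)`. The dependent variables of a potential system are
numbered `0` for `u` and `1` for the potential `v`. -/
def uPart (p : Jet (Fin 2)) : Jet (Fin 1) := (p.1, p.2.1, fun _ => p.2.2 0)

/-- The potential system `v_x = T`, `v_t = -X` of the conserved vector `(T, X)`. -/
def potentialSystem (T X : Jet (Fin 1) → ℝ) : Fin 2 → Jet (Fin 2) → ℝ :=
  ![fun p => p.2.2 1 0 1 - T (uPart p), fun p => p.2.2 1 1 0 + X (uPart p)]

/-- `Q` is a pure (genuinely nonlocal) potential symmetry operator of the equation `L = 0`, for the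
conservation law with conserved vector `(T, X)` and characteristic `lam`: it is a Lie symmetry
operator of the potential system, and at least one of the coefficients of `∂_t`, `∂_x`, `∂_u`
depends on the potential `v`. -/
def IsPurePotentialSymmetryOperator (Ω : Set (Base (Fin 2))) (L T X lam : Jet (Fin 1) → ℝ)
    (Q : Base (Fin 2) → Base (Fin 2)) : Prop :=
  HasCharacteristic L T X lam ∧
    IsLieSymmetryOperator Ω (potentialSystem T X) Q ∧
    ∃ t x u v v' : ℝ, (t, x, ![u, v]) ∈ Ω ∧ (t, x, ![u, v']) ∈ Ω ∧
      ¬ ((Q (t, x, ![u, v])).1 = (Q (t, x, ![u, v'])).1 ∧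
        (Q (t, x, ![u, v])).2.1 = (Q (t, x, ![u, v'])).2.1 ∧
        (Q (t, x, ![u, v])).2.2 0 = (Q (t, x, ![u, v'])).2.2 0)

/-! ### The heat equation and the characteristic `x` -/

/-- The linear heat equation `u_t - u_xx = 0`. -/
def heatEq (p : Jet (Fin 1)) : ℝ := p.2.2 0 1 0 - p.2.2 0 0 2

/-- The function `x`. -/
def charX (p : Jet (Fin 1)) : ℝ := p.2.1

/-- The density `x u`. -/
def densityX (p : Jet (Fin 1)) : ℝ := p.2.1 * p.2.2 0 0 0

/-- The flux `u - x u_x`. -/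
def fluxX (p : Jet (Fin 1)) : ℝ := p.2.2 0 0 0 - p.2.1 * p.2.2 0 0 1

/-- The potential system of the conserved vector `(x u, u - x u_x)` is
`v_x = x u`, `v_t = x u_x - u`. -/
theorem potentialSystem_densityX_fluxX (p : Jet (Fin 2)) :
    (∀ μ, potentialSystem densityX fluxX μ p = 0) ↔
      p.2.2 1 0 1 = p.2.1 * p.2.2 0 0 0 ∧
        p.2.2 1 1 0 = p.2.1 * p.2.2 0 0 1 - p.2.2 0 0 0 := by
  simp only [Fin.forall_fin_two, potentialSystem, densityX, fluxX, uPart, Matrix.cons_val_zero,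
    Matrix.cons_val_one]
  constructor <;> rintro ⟨h1, h2⟩ <;> constructor <;> linarith

/-- The potential equation `v_t + (2/x) v_x - v_xx = 0`. -/
def potentialEq (p : Jet (Fin 1)) : ℝ :=
  p.2.2 0 1 0 + 2 / p.2.1 * p.2.2 0 0 1 - p.2.2 0 0 2

/-- The operators `∂_t`, `2t ∂_t + x ∂_x`, `4t² ∂_t + 4tx ∂_x - (x² - 2t) v ∂_v`, `v ∂_v`. -/
def eqOp : Fin 4 → Base (Fin 1) → Base (Fin 1) :=
  ![fun _ => (1, 0, ![0]),
    fun p => (2 * p.1, p.2.1, ![0]),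
    fun p => (4 * p.1 ^ 2, 4 * p.1 * p.2.1, ![-(p.2.1 ^ 2 - 2 * p.1) * p.2.2 0]),
    fun p => (0, 0, ![p.2.2 0])]

/-- The operator `f ∂_v`, `f = f(t, x)`. -/
def eqOpOf (f : ℝ × ℝ → ℝ) (p : Base (Fin 1)) : Base (Fin 1) := (0, 0, ![f (p.1, p.2.1)])

/-- The algebra `𝔱₀`, where `f` runs through the solutions of the potential equation on `D`. -/
def algT0 (D : Set (ℝ × ℝ)) : Submodule ℝ (Base (Fin 1) → Base (Fin 1)) :=
  Submodule.span ℝ (Set.range eqOp ∪ {Q | ∃ f, IsSolutionOn D potentialEq f ∧ Q = eqOpOf f})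

/-- The operators `∂_t`, `2t ∂_t + x ∂_x - 2u ∂_u`,
`4t² ∂_t + 4tx ∂_x - ((x² + 6t) u + 2v) ∂_u - (x² - 2t) v ∂_v`, `u ∂_u + v ∂_v`. -/
def sysOp : Fin 4 → Base (Fin 2) → Base (Fin 2) :=
  ![fun _ => (1, 0, ![0, 0]),
    fun p => (2 * p.1, p.2.1, ![-2 * p.2.2 0, 0]),
    fun p => (4 * p.1 ^ 2, 4 * p.1 * p.2.1,
      ![-((p.2.1 ^ 2 + 6 * p.1) * p.2.2 0 + 2 * p.2.2 1), -(p.2.1 ^ 2 - 2 * p.1) * p.2.2 1]),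
    fun p => (0, 0, ![p.2.2 0, p.2.2 1])]

/-- The operator `x⁻¹ f_x ∂_u + f ∂_v`, `f = f(t, x)`. -/
def sysOpOf (f : ℝ × ℝ → ℝ) (p : Base (Fin 2)) : Base (Fin 2) :=
  (0, 0, ![p.2.1⁻¹ * partialX f (p.1, p.2.1), f (p.1, p.2.1)])

/-- The algebra `𝔱₁`, where `f` runs through the solutions of the potential equation on `D`. -/
def algT1 (D : Set (ℝ × ℝ)) : Submodule ℝ (Base (Fin 2) → Base (Fin 2)) :=
  Submodule.span ℝ (Set.range sysOp ∪ {Q | ∃ f, IsSolutionOn D potentialEq f ∧ Q = sysOpOf f})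

/-- The set of the `(t, x, v)` with `(t, x) ∈ D` and `v ∈ J`. -/
def eqDomain (D : Set (ℝ × ℝ)) (J : Set ℝ) : Set (Base (Fin 1)) :=
  {p | (p.1, p.2.1) ∈ D ∧ p.2.2 0 ∈ J}

/-- The set of the `(t, x, u, v)` with `(t, x) ∈ D`, `u ∈ I` and `v ∈ J`. -/
def sysDomain (D : Set (ℝ × ℝ)) (I J : Set ℝ) : Set (Base (Fin 2)) :=
  {p | (p.1, p.2.1) ∈ D ∧ p.2.2 0 ∈ I ∧ p.2.2 1 ∈ J}

end

/-!
The proof solves the determining equations of the two systems.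

For a vector field `τ ∂_t + ξ ∂_x + …` the invariance condition is a polynomial in the derivatives
of the dependent variables that are left free by the system, with coefficients that are
differential expressions in `τ`, `ξ`, …; it has to vanish identically, so every coefficient
vanishes. For the potential equation the free derivatives are `v_x`, `v_xx`, `v_tx`, and the
splitting shows that `τ = τ(t)`, `ξ_v = 0`, `2 ξ_x = τ_t` and `η = A(t, x) v + B(t, x)`, where
`2 x² A_x + x² ξ_t + 2 ξ - x τ_t = 0` and both `A` and `B` solve the potential equation
(`exists_eqField_of_isLieSymmetryOperator`). For the potential system the free derivatives are
`u_t` and `u_x`; after a further splitting with respect to `u`, the same equations are found for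
`τ`, `ξ` and the coefficient `η` of `∂_v`, and the coefficient `φ` of `∂_u` is expressed by them
through the first condition (`exists_sysField_of_isLieSymmetryOperator`).

The common remaining system is solved in `exists_coeff_of_determining`. With `σ = ξ - x τ_t / 2`,
which depends on `t` only, the compatibility of the expressions for `A_x` and `A_t` is
`48 σ = 2 x⁴ σ_tt + x⁵ τ_ttt`. This is polynomial in `x`, hence `σ = 0` and `τ_ttt = 0`, and the
connectedness of `D` makes the four integration constants global. Differentiating in `x` instead of
comparing coefficients avoids any discussion of the slices of `D`, which need not be connected.

Conversely, the listed operators satisfy the invariance conditions by the explicit prolongation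
formulas `lineDeriv_potentialEq_prolongation` and `lineDeriv_potentialSystem_prolongation`. The
algebras are closed under the Lie bracket because the point symmetries act on the solutions of the
potential equation (`IsSolutionOn.symmetryAction`). Finally, the only coefficient of `∂_t`, `∂_x`,
`∂_u` in a general element of `𝔱₁` that depends on `v` is that of `∂_u`, through the term
`-2 c₂ v`.
-/

/-! ### Directional derivatives of smooth functions -/

section DirDeriv

variable {E : Type*} [NormedAddCommGroup E] [NormedSpace ℝ E]

/-- The derivative of `F` in the constant direction `w`, as a function of the point. -/
noncomputable def dirDeriv (w : E) (F : E → ℝ) (p : E) : ℝ := lineDeriv ℝ F p w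

variable {w w' p : E} {F G : E → ℝ} {Ω : Set E}

lemma dirDeriv_eq_fderiv (hF : DifferentiableAt ℝ F p) : dirDeriv w F p = fderiv ℝ F p w :=
  hF.lineDeriv_eq_fderiv

lemma ContDiffAt.diffAt (hF : ContDiffAt ℝ ∞ F p) : DifferentiableAt ℝ F p :=
  hF.differentiableAt (by simp)

lemma dirDeriv_const (c : ℝ) : dirDeriv w (fun _ => c) p = 0 := by
  simp [dirDeriv, lineDeriv]

lemma dirDeriv_add (hF : ContDiffAt ℝ ∞ F p) (hG : ContDiffAt ℝ ∞ G p) :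
    dirDeriv w (fun q => F q + G q) p = dirDeriv w F p + dirDeriv w G p := by
  rw [dirDeriv_eq_fderiv (hF.diffAt.fun_add hG.diffAt), dirDeriv_eq_fderiv hF.diffAt,
    dirDeriv_eq_fderiv hG.diffAt, fderiv_fun_add hF.diffAt hG.diffAt]; rfl

lemma dirDeriv_sub (hF : ContDiffAt ℝ ∞ F p) (hG : ContDiffAt ℝ ∞ G p) :
    dirDeriv w (fun q => F q - G q) p = dirDeriv w F p - dirDeriv w G p := by
  rw [dirDeriv_eq_fderiv (hF.diffAt.fun_sub hG.diffAt), dirDeriv_eq_fderiv hF.diffAt,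
    dirDeriv_eq_fderiv hG.diffAt, fderiv_fun_sub hF.diffAt hG.diffAt]; rfl

lemma dirDeriv_neg (hF : ContDiffAt ℝ ∞ F p) :
    dirDeriv w (fun q => -F q) p = -dirDeriv w F p := by
  rw [dirDeriv_eq_fderiv hF.diffAt.fun_neg, dirDeriv_eq_fderiv hF.diffAt, fderiv_fun_neg]; rfl

lemma dirDeriv_mul (hF : ContDiffAt ℝ ∞ F p) (hG : ContDiffAt ℝ ∞ G p) :
    dirDeriv w (fun q => F q * G q) p = F p * dirDeriv w G p + G p * dirDeriv w F p := by
  rw [dirDeriv_eq_fderiv (hF.diffAt.fun_mul hG.diffAt), dirDeriv_eq_fderiv hF.diffAt,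
    dirDeriv_eq_fderiv hG.diffAt, fderiv_fun_mul hF.diffAt hG.diffAt]; rfl

lemma dirDeriv_pow (hF : ContDiffAt ℝ ∞ F p) (n : ℕ) :
    dirDeriv w (fun q => F q ^ n) p = n * F p ^ (n - 1) * dirDeriv w F p := by
  rw [dirDeriv_eq_fderiv (hF.diffAt.fun_pow n), dirDeriv_eq_fderiv hF.diffAt,
    fderiv_fun_pow n hF.diffAt]
  simp

lemma dirDeriv_inv (hF : ContDiffAt ℝ ∞ F p) (h0 : F p ≠ 0) :
    dirDeriv w (fun q => (F q)⁻¹) p = -dirDeriv w F p / F p ^ 2 := by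
  have h : HasDerivAt (fun s : ℝ => F (p + s • w)) (dirDeriv w F p) 0 :=
    hF.diffAt.lineDifferentiableAt.hasLineDerivAt
  have := h.fun_inv (by simpa using h0)
  simpa [dirDeriv, lineDeriv] using this.deriv

@[fun_prop]
lemma ContDiffAt.dirDeriv (hF : ContDiffAt ℝ ∞ F p) : ContDiffAt ℝ ∞ (dirDeriv w F) p := by
  have h : ContDiffAt ℝ ∞ (fun q => fderiv ℝ F q w) p :=
    (hF.fderiv_right (m := ∞) (by simp)).clm_apply contDiffAt_const
  refine h.congr_of_eventuallyEq ?_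
  have h1 : ∀ᶠ q in nhds p, ContDiffAt ℝ 1 F q :=
    (hF.of_le (by simp)).eventually (by simp)
  filter_upwards [h1] with q hq
  exact dirDeriv_eq_fderiv (hq.differentiableAt (by simp))

lemma dirDeriv_congr (hΩ : IsOpen Ω) (h : ∀ q ∈ Ω, F q = G q) (hp : p ∈ Ω) :
    dirDeriv w F p = dirDeriv w G p :=
  Filter.EventuallyEq.lineDeriv_eq (Filter.eventually_of_mem (hΩ.mem_nhds hp) h)

/-- Mixed directional derivatives of a smooth function commute. -/
lemma dirDeriv_comm (hF : ContDiffAt ℝ ∞ F p) :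
    dirDeriv w (dirDeriv w' F) p = dirDeriv w' (dirDeriv w F) p := by
  have h1 : ∀ᶠ q in nhds p, ContDiffAt ℝ 1 F q :=
    (hF.of_le (by simp)).eventually (by simp)
  have h2 : DifferentiableAt ℝ (fderiv ℝ F) p :=
    (hF.fderiv_right (m := ∞) (by simp)).differentiableAt (by simp)
  have key : ∀ a b : E, dirDeriv a (dirDeriv b F) p = fderiv ℝ (fderiv ℝ F) p a b := by
    intro a b
    have h3 : dirDeriv b F =ᶠ[nhds p] fun q => fderiv ℝ F q b := by
      filter_upwards [h1] with q hq
      exact dirDeriv_eq_fderiv (hq.differentiableAt (by simp))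
    rw [dirDeriv, h3.lineDeriv_eq, ← dirDeriv,
      dirDeriv_eq_fderiv (h2.clm_apply (differentiableAt_const b)),
      fderiv_clm_apply h2 (differentiableAt_const b)]
    simp
  rw [key, key]
  exact hF.isSymmSndFDerivAt
    (by simpa using (WithTop.coe_le_coe.2 le_top : ((2 : ℕ∞) : WithTop ℕ∞) ≤ ∞)) w w'

lemma ContDiffOn.smoothAt (hF : ContDiffOn ℝ ∞ F Ω) (hΩ : IsOpen Ω) (hp : p ∈ Ω) :
    ContDiffAt ℝ ∞ F p := hF.contDiffAt (hΩ.mem_nhds hp)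

lemma ContDiffOn.dirDeriv (hΩ : IsOpen Ω) (hF : ContDiffOn ℝ ∞ F Ω) :
    ContDiffOn ℝ ∞ (dirDeriv w F) Ω :=
  fun _ hp => (hF.smoothAt hΩ hp).dirDeriv.contDiffWithinAt

/-- A function that has no derivative along a segment takes the same value at its end points. -/
lemma eq_of_dirDeriv_eq_zero {q : E} (hF : ∀ r ∈ segment ℝ p q, DifferentiableAt ℝ F r)
    (h : ∀ r ∈ segment ℝ p q, dirDeriv (q - p) F r = 0) : F p = F q := by
  have hseg : ∀ s ∈ Set.Icc (0 : ℝ) 1, p + s • (q - p) ∈ segment ℝ p q := by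
    intro s hs
    rw [segment_eq_image']
    exact ⟨s, hs, rfl⟩
  have hd : ∀ s ∈ Set.Icc (0 : ℝ) 1, HasDerivAt (fun s : ℝ => F (p + s • (q - p))) 0 s := by
    intro s hs
    have h1 := (hF _ (hseg s hs)).hasFDerivAt
    have h2 : HasDerivAt (fun s : ℝ => p + s • (q - p)) (q - p) s := by
      simpa using ((hasDerivAt_id s).smul_const (q - p)).const_add p
    have h3 := h1.comp_hasDerivAt s h2
    rwa [← dirDeriv_eq_fderiv (hF _ (hseg s hs)), h _ (hseg s hs)] at h3
  have := constant_of_has_deriv_right_zero (a := (0 : ℝ)) (b := 1)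
    (f := fun s : ℝ => F (p + s • (q - p)))
    (fun s hs => (hd s hs).continuousAt.continuousWithinAt)
    (fun s hs => (hd s (Set.Ico_subset_Icc_self hs)).hasDerivWithinAt) 1 (by simp)
  simpa using this.symm

end DirDeriv

/-! ### Differential calculus in two variables -/

lemma dirDeriv_coordT {w p : ℝ × ℝ} : dirDeriv w (fun q => q.1) p = w.1 := by
  simp [dirDeriv, lineDeriv]

lemma dirDeriv_coordX {w p : ℝ × ℝ} : dirDeriv w (fun q => q.2) p = w.2 := by
  simp [dirDeriv, lineDeriv]

lemma partialT_eq_dirDeriv : partialT = dirDeriv ((1, 0) : ℝ × ℝ) := rfl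

lemma partialX_eq_dirDeriv : partialX = dirDeriv ((0, 1) : ℝ × ℝ) := rfl

section TwoVariables

variable {D : Set (ℝ × ℝ)} {F G : ℝ × ℝ → ℝ}

lemma smooth_partialT (hD : IsOpen D) (hF : ContDiffOn ℝ ∞ F D) :
    ContDiffOn ℝ ∞ (partialT F) D := hF.dirDeriv hD

lemma smooth_partialX (hD : IsOpen D) (hF : ContDiffOn ℝ ∞ F D) :
    ContDiffOn ℝ ∞ (partialX F) D := hF.dirDeriv hD

lemma partialX_partialT (hD : IsOpen D) (hF : ContDiffOn ℝ ∞ F D) {z : ℝ × ℝ} (hz : z ∈ D) :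
    partialX (partialT F) z = partialT (partialX F) z := dirDeriv_comm (hF.smoothAt hD hz)

lemma partialT_congr (hD : IsOpen D) (h : ∀ z ∈ D, F z = G z) :
    ∀ z ∈ D, partialT F z = partialT G z := fun _ hz => dirDeriv_congr hD h hz

lemma partialX_congr (hD : IsOpen D) (h : ∀ z ∈ D, F z = G z) :
    ∀ z ∈ D, partialX F z = partialX G z := fun _ hz => dirDeriv_congr hD h hz

lemma exists_eq_const (hD : IsOpen D) (hDc : IsConnected D) (hF : ContDiffOn ℝ ∞ F D)
    (hT : ∀ z ∈ D, partialT F z = 0) (hX : ∀ z ∈ D, partialX F z = 0) :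
    ∃ c, ∀ z ∈ D, F z = c := by
  obtain ⟨z₀, hz₀⟩ := hDc.nonempty
  refine ⟨F z₀, fun z hz => hD.is_const_of_fderiv_eq_zero (𝕜 := ℝ) hDc.isPreconnected
    (hF.differentiableOn (by simp)) (fun y hy => ?_) hz hz₀⟩
  have hd := (hF.smoothAt hD hy).diffAt
  ext
  · simpa [← dirDeriv_eq_fderiv hd, partialT_eq_dirDeriv] using hT y hy
  · simpa [← dirDeriv_eq_fderiv hd, partialX_eq_dirDeriv] using hX y hy

lemma partialT_congr_zero (hD : IsOpen D) (h : ∀ z ∈ D, F z = 0) :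
    ∀ z ∈ D, partialT F z = 0 := fun z hz => by
  rw [partialT_congr hD (G := fun _ => 0) h z hz, partialT_eq_dirDeriv, dirDeriv_const]

lemma partialX_congr_zero (hD : IsOpen D) (h : ∀ z ∈ D, F z = 0) :
    ∀ z ∈ D, partialX F z = 0 := fun z hz => by
  rw [partialX_congr hD (G := fun _ => 0) h z hz, partialX_eq_dirDeriv, dirDeriv_const]

/-- The general solution of the determining equations for `τ`, `ξ`, `A` that the symmetries
`τ ∂_t + ξ ∂_x + (A v + B) ∂_v` of the potential equation and the symmetries of the potential
system have in common. -/
theorem exists_coeff_of_determining (hD : IsOpen D) (hDc : IsConnected D)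
    (hDx : ∀ z ∈ D, z.2 ≠ 0) {τ ξ A : ℝ × ℝ → ℝ}
    (hτ : ContDiffOn ℝ ∞ τ D) (hξ : ContDiffOn ℝ ∞ ξ D) (hA : ContDiffOn ℝ ∞ A D)
    (h1 : ∀ z ∈ D, partialX τ z = 0) (h2 : ∀ z ∈ D, 2 * partialX ξ z = partialT τ z)
    (h3 : ∀ z ∈ D, z.2 ^ 2 * (2 * partialX A z + partialT ξ z) + 2 * ξ z
      - z.2 * partialT τ z = 0)
    (h4 : ∀ z ∈ D, z.2 * partialT A z - z.2 * partialX (partialX A) z + 2 * partialX A z = 0) :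
    ∃ c : Fin 4 → ℝ, ∀ z ∈ D, τ z = c 0 + 2 * c 1 * z.1 + 4 * c 2 * z.1 ^ 2 ∧
      ξ z = c 1 * z.2 + 4 * c 2 * z.1 * z.2 ∧
      A z = c 3 - c 2 * (z.2 ^ 2 - 2 * z.1) := by
  have sT {F : ℝ × ℝ → ℝ} (h : ContDiffOn ℝ ∞ F D) := smooth_partialT hD h
  have sX {F : ℝ × ℝ → ℝ} (h : ContDiffOn ℝ ∞ F D) := smooth_partialX hD h
  -- `σ` is the deviation of `ξ` from the expected value; it depends on `t` only, as `τ` does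
  obtain ⟨σ, hσ⟩ : ∃ σ : ℝ × ℝ → ℝ, σ = fun z => ξ z - z.2 * (partialT τ z / 2) := ⟨_, rfl⟩
  have sσ : ContDiffOn ℝ ∞ σ D := by
    rw [hσ]; exact hξ.sub (contDiff_snd.contDiffOn.mul ((sT hτ).div_const 2))
  have hξσ : ξ = fun z => σ z + z.2 * (partialT τ z / 2) := by rw [hσ]; simp
  have e1 : ∀ z ∈ D, partialX (partialT τ) z = 0 := fun z hz => by
    rw [partialX_partialT hD hτ hz, partialT_congr_zero hD h1 z hz]
  have e2 : ∀ z ∈ D, partialX (partialT (partialT τ)) z = 0 := fun z hz => by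
    rw [partialX_partialT hD (sT hτ) hz, partialT_congr_zero hD e1 z hz]
  have e3 : ∀ z ∈ D, partialX (partialT (partialT (partialT τ))) z = 0 := fun z hz => by
    rw [partialX_partialT hD (sT (sT hτ)) hz, partialT_congr_zero hD e2 z hz]
  have dτ := fun z hz => hτ.smoothAt hD (p := z) hz
  have dξ := fun z hz => hξ.smoothAt hD (p := z) hz
  have dσ := fun z hz => sσ.smoothAt hD (p := z) hz
  have dA := fun z hz => hA.smoothAt hD (p := z) hz
  have f1 : ∀ z ∈ D, partialX σ z = 0 := fun z hz => by
    have d1 := dτ z hz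
    have d2 := dξ z hz
    have g1 := e1 z hz
    have g2 := h2 z hz
    rw [hσ]
    simp only [partialX_eq_dirDeriv, partialT_eq_dirDeriv] at *
    simp (disch := fun_prop) only [dirDeriv_sub, dirDeriv_mul, dirDeriv_coordX,
      dirDeriv_const, div_eq_mul_inv, g1]
    linarith
  have f2 : ∀ z ∈ D, partialX (partialT σ) z = 0 := fun z hz => by
    rw [partialX_partialT hD sσ hz, partialT_congr_zero hD f1 z hz]
  have f3 : ∀ z ∈ D, partialX (partialT (partialT σ)) z = 0 := fun z hz => by
    rw [partialX_partialT hD (sT sσ) hz, partialT_congr_zero hD f2 z hz]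
  have f4 : ∀ z ∈ D, partialT ξ z = partialT σ z + z.2 * (partialT (partialT τ) z / 2) :=
    fun z hz => by
    have d1 := dτ z hz
    have d2 := dσ z hz
    rw [hξσ]
    simp only [partialX_eq_dirDeriv, partialT_eq_dirDeriv] at *
    simp (disch := fun_prop) only [dirDeriv_add, dirDeriv_mul, dirDeriv_coordX,
      dirDeriv_const, div_eq_mul_inv]
    ring
  -- `A_x` and `A_t` in terms of `σ` and `τ`, and their derivatives in `t` and `x`
  have k1 : ∀ z ∈ D, z.2 ^ 2 * partialX A z =
      -(z.2 ^ 2 * partialT σ z / 2) - z.2 ^ 3 * partialT (partialT τ) z / 4 - σ z :=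
    fun z hz => by
    have g := h3 z hz
    rw [f4 z hz, congrFun hξσ z] at g
    linear_combination g / 2
  have k2 : ∀ z ∈ D, 2 * z.2 * partialX A z + z.2 ^ 2 * partialX (partialX A) z =
      -(z.2 * partialT σ z) - 3 * z.2 ^ 2 * partialT (partialT τ) z / 4 := fun z hz => by
    have g := partialX_congr hD k1 z hz
    have d1 := dτ z hz
    have d2 := dσ z hz
    have d4 := dA z hz
    have g1 := f1 z hz
    have g2 := f2 z hz
    have g3 := e2 z hz
    simp only [partialX_eq_dirDeriv, partialT_eq_dirDeriv] at *
    simp (disch := fun_prop) only [dirDeriv_sub, dirDeriv_neg, dirDeriv_mul, dirDeriv_pow,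
      dirDeriv_coordX, dirDeriv_const, div_eq_mul_inv, g1, g2, g3] at g
    push_cast at g
    linear_combination g
  have k3 : ∀ z ∈ D, z.2 ^ 3 * partialT A z =
      z.2 ^ 2 * partialT σ z + z.2 ^ 3 * partialT (partialT τ) z / 4 + 4 * σ z := fun z hz => by
    linear_combination z.2 ^ 2 * h4 z hz + z.2 * k2 z hz - 4 * k1 z hz
  have k4 : ∀ z ∈ D, 3 * z.2 ^ 2 * partialT A z + z.2 ^ 3 * partialX (partialT A) z =
      2 * z.2 * partialT σ z + 3 * z.2 ^ 2 * partialT (partialT τ) z / 4 := fun z hz => by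
    have g := partialX_congr hD k3 z hz
    have d1 := dτ z hz
    have d2 := dσ z hz
    have d4 := dA z hz
    have g1 := f1 z hz
    have g2 := f2 z hz
    have g3 := e2 z hz
    simp only [partialX_eq_dirDeriv, partialT_eq_dirDeriv] at *
    simp (disch := fun_prop) only [dirDeriv_add, dirDeriv_mul, dirDeriv_pow,
      dirDeriv_coordX, dirDeriv_const, div_eq_mul_inv, g1, g2, g3] at g
    push_cast at g
    linear_combination g
  have k5 : ∀ z ∈ D, z.2 ^ 2 * partialX (partialT A) z = -(z.2 ^ 2 * partialT (partialT σ) z / 2)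
      - z.2 ^ 3 * partialT (partialT (partialT τ)) z / 4 - partialT σ z := fun z hz => by
    have g := partialT_congr hD k1 z hz
    rw [partialX_partialT hD hA hz]
    have d1 := dτ z hz
    have d2 := dσ z hz
    have d4 := dA z hz
    simp only [partialX_eq_dirDeriv, partialT_eq_dirDeriv] at *
    simp (disch := fun_prop) only [dirDeriv_sub, dirDeriv_neg, dirDeriv_mul, dirDeriv_pow,
      dirDeriv_coordX, dirDeriv_const, div_eq_mul_inv] at g
    push_cast at g
    linear_combination g
  -- the compatibility condition `A_tx = A_xt`; `σ`, `σ_tt`, `τ_ttt` do not depend on `x`, so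
  -- differentiating this polynomial relation in `x` separates its coefficients
  have k6 : ∀ z ∈ D, 48 * σ z = 2 * z.2 ^ 4 * partialT (partialT σ) z
      + z.2 ^ 5 * partialT (partialT (partialT τ)) z := fun z hz => by
    linear_combination 4 * z.2 * k4 z hz - 12 * k3 z hz - 4 * z.2 ^ 2 * k5 z hz
  have k7 : ∀ z ∈ D, 8 * partialT (partialT σ) z
      + 5 * z.2 * partialT (partialT (partialT τ)) z = 0 := fun z hz => by
    have g := partialX_congr hD k6 z hz
    have d1 := dτ z hz
    have d2 := dσ z hz
    have g1 := f1 z hz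
    have g2 := f3 z hz
    have g3 := e3 z hz
    have hx := hDx z hz
    simp only [partialX_eq_dirDeriv, partialT_eq_dirDeriv] at *
    simp (disch := fun_prop) only [dirDeriv_add, dirDeriv_mul, dirDeriv_pow,
      dirDeriv_coordX, dirDeriv_const, g1, g2, g3] at g
    push_cast at g
    refine mul_left_cancel₀ (pow_ne_zero 3 hx) ?_
    linear_combination -g
  have k8 : ∀ z ∈ D, partialT (partialT (partialT τ)) z = 0 := fun z hz => by
    have g := partialX_congr_zero hD k7 z hz
    have d1 := dτ z hz
    have d3 := dσ z hz
    have g2 := f3 z hz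
    have g3 := e3 z hz
    simp only [partialX_eq_dirDeriv, partialT_eq_dirDeriv] at *
    simp (disch := fun_prop) only [dirDeriv_add, dirDeriv_mul, dirDeriv_coordX,
      dirDeriv_const, g2, g3] at g
    linear_combination g / 5
  have k9 : ∀ z ∈ D, σ z = 0 := fun z hz => by
    linear_combination k6 z hz / 48 + z.2 ^ 4 / 192 * k7 z hz
      - z.2 ^ 5 / 192 * k8 z hz
  have k10 : ∀ z ∈ D, partialT σ z = 0 := partialT_congr_zero hD k9
  -- the integration constants are `τ_tt`, then those of `τ_t`, `τ` and `A`
  obtain ⟨a, ha⟩ := exists_eq_const hD hDc (sT (sT hτ)) k8 e2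
  obtain ⟨b, hb⟩ := exists_eq_const hD hDc (F := fun z => partialT τ z - a * z.1)
    ((sT hτ).sub (contDiffOn_const.mul contDiff_fst.contDiffOn))
    (fun z hz => by
      have d1 := dτ z hz
      have g := ha z hz
      simp only [partialX_eq_dirDeriv, partialT_eq_dirDeriv] at *
      simp (disch := fun_prop) only [dirDeriv_sub, dirDeriv_mul, dirDeriv_coordT, dirDeriv_const]
      linear_combination g)
    (fun z hz => by
      have d1 := dτ z hz
      have g := e1 z hz
      simp only [partialX_eq_dirDeriv, partialT_eq_dirDeriv] at *
      simp (disch := fun_prop) only [dirDeriv_sub, dirDeriv_mul, dirDeriv_coordT, dirDeriv_const]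
      linear_combination g)
  obtain ⟨d, hd⟩ := exists_eq_const hD hDc (F := fun z => τ z - (b * z.1 + a / 2 * z.1 ^ 2))
    (hτ.sub (contDiff_fst.contDiffOn.const_smul b |>.add
      ((contDiff_fst.pow 2).contDiffOn.const_smul (a / 2))))
    (fun z hz => by
      have d1 := dτ z hz
      have g := hb z hz
      simp only [partialX_eq_dirDeriv, partialT_eq_dirDeriv] at *
      simp (disch := fun_prop) only [dirDeriv_add, dirDeriv_sub, dirDeriv_mul, dirDeriv_pow,
        dirDeriv_coordT, dirDeriv_const, div_eq_mul_inv]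
      push_cast
      linear_combination g)
    (fun z hz => by
      have d1 := dτ z hz
      have g := h1 z hz
      simp only [partialX_eq_dirDeriv, partialT_eq_dirDeriv] at *
      simp (disch := fun_prop) only [dirDeriv_add, dirDeriv_sub, dirDeriv_mul, dirDeriv_pow,
        dirDeriv_coordT, dirDeriv_const, div_eq_mul_inv]
      linear_combination g)
  obtain ⟨m, hm⟩ := exists_eq_const hD hDc (F := fun z => A z + a / 8 * (z.2 ^ 2 - 2 * z.1))
    (hA.add (((contDiff_snd.pow 2).contDiffOn.sub
      (contDiff_fst.contDiffOn.const_smul (2 : ℝ))).const_smul (a / 8)))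
    (fun z hz => by
      have d1 := dA z hz
      have hx := hDx z hz
      have g := k3 z hz
      rw [k10 z hz, ha z hz, k9 z hz] at g
      simp only [partialX_eq_dirDeriv, partialT_eq_dirDeriv] at *
      simp (disch := fun_prop) only [dirDeriv_add, dirDeriv_sub, dirDeriv_mul, dirDeriv_pow,
        dirDeriv_coordX, dirDeriv_coordT, dirDeriv_const, div_eq_mul_inv]
      push_cast
      refine mul_left_cancel₀ (pow_ne_zero 3 hx) ?_
      linear_combination g)
    (fun z hz => by
      have d1 := dA z hz
      have hx := hDx z hz
      have g := k1 z hz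
      rw [k10 z hz, ha z hz, k9 z hz] at g
      simp only [partialX_eq_dirDeriv, partialT_eq_dirDeriv] at *
      simp (disch := fun_prop) only [dirDeriv_add, dirDeriv_sub, dirDeriv_mul, dirDeriv_pow,
        dirDeriv_coordX, dirDeriv_coordT, dirDeriv_const, div_eq_mul_inv]
      push_cast
      refine mul_left_cancel₀ (pow_ne_zero 2 hx) ?_
      linear_combination g)
  refine ⟨![d, b / 2, a / 8, m], fun z hz => ⟨?_, ?_, ?_⟩⟩
  · have := hd z hz
    simp only [Matrix.cons_val]
    linear_combination this
  · have g := hb z hz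
    rw [congrFun hξσ z, k9 z hz]
    simp only [Matrix.cons_val]
    linear_combination z.2 / 2 * g
  · have := hm z hz
    simp only [Matrix.cons_val]
    linear_combination this

end TwoVariables

/-! ### Directional derivatives on the space of variables -/

section BaseSpace

variable {ι : Type}

/-- The direction of `∂_t`. -/
abbrev eT : Base ι := (1, 0, 0)

/-- The direction of `∂_x`. -/
abbrev eX : Base ι := (0, 1, 0)

/-- The direction of `∂_{u^i}`. -/
abbrev eU [DecidableEq ι] (i : ι) : Base ι := (0, 0, Pi.single i 1)

variable [Fintype ι]

lemma dirDeriv_baseT {w p : Base ι} : dirDeriv w (fun q => q.1) p = w.1 := by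
  simp [dirDeriv, lineDeriv]

lemma dirDeriv_baseX {w p : Base ι} : dirDeriv w (fun q => q.2.1) p = w.2.1 := by
  simp [dirDeriv, lineDeriv]

lemma dirDeriv_baseU {w p : Base ι} {i : ι} : dirDeriv w (fun q => q.2.2 i) p = w.2.2 i := by
  simp [dirDeriv, lineDeriv]

lemma dirDeriv_comp_baseTX {w p : Base ι} {f : ℝ × ℝ → ℝ} :
    dirDeriv w (fun q => f (q.1, q.2.1)) p = dirDeriv (w.1, w.2.1) f (p.1, p.2.1) := rfl

/-- A derivative along a direction of the plane `u = const` is a derivative of the restriction. -/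
lemma dirDeriv_restrict {F : Base ι → ℝ} {w : ℝ × ℝ} {c : ι → ℝ} :
    dirDeriv w (fun z => F (z.1, z.2, c))
      = fun z => dirDeriv ((w.1, w.2, 0) : Base ι) F (z.1, z.2, c) := by
  ext z
  simp [dirDeriv, lineDeriv]

lemma dirDeriv_eq_sum [DecidableEq ι] {F : Base ι → ℝ} {p : Base ι} (hF : ContDiffAt ℝ ∞ F p)
    (w : Base ι) : dirDeriv w F p = w.1 * dirDeriv eT F p + w.2.1 * dirDeriv eX F p
      + ∑ i, w.2.2 i * dirDeriv (eU i) F p := by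
  have hw : w = w.1 • eT + w.2.1 • eX + ∑ i, w.2.2 i • eU i := by
    ext i
    · simp [Prod.fst_sum]
    · simp [Prod.fst_sum, Prod.snd_sum]
    · simp [Prod.snd_sum, Finset.sum_apply, Pi.single_apply]
  simp only [dirDeriv_eq_fderiv hF.diffAt]
  conv_lhs => rw [hw]
  simp only [map_add, map_sum, map_smul, smul_eq_mul]

/-! ### Prolongations -/

lemma lineDeriv_comp_jetBase (F : Base ι → ℝ) (p W : Jet ι) :
    lineDeriv ℝ (fun q => F (jetBase q)) p W = dirDeriv (jetBase W) F (jetBase p) := rfl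

variable [DecidableEq ι]

lemma totalT_comp_jetBase {F : Base ι → ℝ} {p : Jet ι} (hF : ContDiffAt ℝ ∞ F (jetBase p)) :
    totalT (fun q => F (jetBase q)) p = dirDeriv eT F (jetBase p)
      + ∑ i, p.2.2 i 1 0 * dirDeriv (eU i) F (jetBase p) := by
  rw [totalT, lineDeriv_comp_jetBase, dirDeriv_eq_sum hF]
  simp [jetBase]

lemma totalX_comp_jetBase {F : Base ι → ℝ} {p : Jet ι} (hF : ContDiffAt ℝ ∞ F (jetBase p)) :
    totalX (fun q => F (jetBase q)) p = dirDeriv eX F (jetBase p)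
      + ∑ i, p.2.2 i 0 1 * dirDeriv (eU i) F (jetBase p) := by
  rw [totalX, lineDeriv_comp_jetBase, dirDeriv_eq_sum hF]
  simp [jetBase]

end BaseSpace

lemma prolongCoeff_succ_right {ι : Type} (Q : Base ι → Base ι) (i : ι) (j k : ℕ) (p : Jet ι) :
    prolongCoeff Q i j (k + 1) p = totalX (prolongCoeff Q i j k) p
      - totalX (fun q => (Q (jetBase q)).1) p * p.2.2 i (j + 1) k
      - totalX (fun q => (Q (jetBase q)).2.1) p * p.2.2 i j (k + 1) := by
  cases j <;> simp only [prolongCoeff]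

lemma hasDerivAt_comp_jetBase {ι : Type} [Fintype ι] {F : Base ι → ℝ} {p : Jet ι}
    (hF : ContDiffAt ℝ ∞ F (jetBase p)) (W : Jet ι) :
    HasDerivAt (fun s : ℝ => F (jetBase (p + s • W))) (dirDeriv (jetBase W) F (jetBase p)) 0 :=
  (hF.diffAt.lineDifferentiableAt (v := jetBase W)).hasLineDerivAt

lemma hasDerivAt_jetCoord {ι : Type} (p W : Jet ι) (i : ι) (j k : ℕ) :
    HasDerivAt (fun s : ℝ => (p + s • W).2.2 i j k) (W.2.2 i j k) 0 := by
  simpa using ((hasDerivAt_id (0 : ℝ)).mul_const (W.2.2 i j k)).const_add (p.2.2 i j k)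

/-- The second total derivative `D_x² F` of a function of the variables `(t, x, v)`. -/
lemma hasDerivAt_totalX_comp_jetBase {F : Base (Fin 1) → ℝ} {p : Jet (Fin 1)}
    {Ω : Set (Base (Fin 1))}
    (hΩ : IsOpen Ω) (hF : ContDiffOn ℝ ∞ F Ω) (hp : jetBase p ∈ Ω) :
    HasDerivAt (fun s : ℝ => totalX (fun q => F (jetBase q))
        (p + s • (0, 1, fun i j k => p.2.2 i j (k + 1))))
      (dirDeriv eX (dirDeriv eX F) (jetBase p)
        + 2 * p.2.2 0 0 1 * dirDeriv eX (dirDeriv (eU 0) F) (jetBase p)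
        + p.2.2 0 0 1 ^ 2 * dirDeriv (eU 0) (dirDeriv (eU 0) F) (jetBase p)
        + p.2.2 0 0 2 * dirDeriv (eU 0) F (jetBase p)) 0 := by
  set W : Jet (Fin 1) := (0, 1, fun i j k => p.2.2 i j (k + 1)) with hW
  have hFp := hF.smoothAt hΩ hp
  have hcont : ContinuousAt (fun s : ℝ => jetBase p + s • jetBase W) 0 := by fun_prop
  have hev : ∀ᶠ s : ℝ in nhds 0, jetBase (p + s • W) ∈ Ω :=
    hcont.preimage_mem_nhds (by simpa using hΩ.mem_nhds hp)
  have h1 := (hasDerivAt_comp_jetBase (F := dirDeriv eX F) hFp.dirDeriv W).add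
    ((hasDerivAt_jetCoord p W 0 0 1).mul
      (hasDerivAt_comp_jetBase (F := dirDeriv (eU 0) F) hFp.dirDeriv W))
  refine (h1.congr_of_eventuallyEq ?_).congr_deriv ?_
  · filter_upwards [hev] with s hs
    rw [totalX_comp_jetBase (hF.smoothAt hΩ hs)]
    simp
  · rw [dirDeriv_eq_sum hFp.dirDeriv, dirDeriv_eq_sum (F := dirDeriv (eU 0) F) hFp.dirDeriv,
      Fin.sum_univ_one, Fin.sum_univ_one, dirDeriv_comm (w := eU 0) (w' := eX) hFp]
    simp [hW, jetBase]
    ring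

lemma lineDeriv_potentialEq {p : Jet (Fin 1)} (hx : p.2.1 ≠ 0) (W : Jet (Fin 1)) :
    lineDeriv ℝ potentialEq p W = W.2.2 0 1 0 + 2 / p.2.1 * W.2.2 0 0 1
      - 2 * W.2.1 / p.2.1 ^ 2 * p.2.2 0 0 1 - W.2.2 0 0 2 := by
  have hX : HasDerivAt (fun s : ℝ => (p + s • W).2.1) W.2.1 0 := by
    simpa using ((hasDerivAt_id (0 : ℝ)).mul_const W.2.1).const_add p.2.1
  have h := ((hasDerivAt_jetCoord p W 0 1 0).add
    (((hasDerivAt_const (0 : ℝ) (2 : ℝ)).div hX (by simpa using hx)).mul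
      (hasDerivAt_jetCoord p W 0 0 1))).sub (hasDerivAt_jetCoord p W 0 0 2)
  refine h.deriv.trans ?_
  simp
  ring

/-- The left-hand side of the invariance condition for the potential equation, written out:
`y₁₀`, `y₀₁`, `y₁₁`, `y₀₂` are the values of `v_t`, `v_x`, `v_tx`, `v_xx`. -/
lemma lineDeriv_potentialEq_prolongation {Ω : Set (Base (Fin 1))} (hΩ : IsOpen Ω)
    {Q : Base (Fin 1) → Base (Fin 1)} {τ ξ η : Base (Fin 1) → ℝ}
    (hQ : ∀ b, Q b = (τ b, ξ b, fun _ => η b))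
    (hτ : ContDiffOn ℝ ∞ τ Ω) (hξ : ContDiffOn ℝ ∞ ξ Ω) (hη : ContDiffOn ℝ ∞ η Ω)
    {b : Base (Fin 1)} (hb : b ∈ Ω) (hx : b.2.1 ≠ 0)
    {p : Jet (Fin 1)} (hp : jetBase p = b) {y₁₀ y₀₁ y₁₁ y₀₂ : ℝ}
    (h10 : p.2.2 0 1 0 = y₁₀) (h01 : p.2.2 0 0 1 = y₀₁)
    (h11 : p.2.2 0 1 1 = y₁₁) (h02 : p.2.2 0 0 2 = y₀₂) :
    lineDeriv ℝ potentialEq p (prolongation Q p) =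
      (dirDeriv eT η b + y₁₀ * dirDeriv (eU 0) η b
        - (dirDeriv eT τ b + y₁₀ * dirDeriv (eU 0) τ b) * y₁₀
        - (dirDeriv eT ξ b + y₁₀ * dirDeriv (eU 0) ξ b) * y₀₁)
      + 2 / b.2.1 * (dirDeriv eX η b + y₀₁ * dirDeriv (eU 0) η b
        - (dirDeriv eX τ b + y₀₁ * dirDeriv (eU 0) τ b) * y₁₀
        - (dirDeriv eX ξ b + y₀₁ * dirDeriv (eU 0) ξ b) * y₀₁)
      - 2 * ξ b / b.2.1 ^ 2 * y₀₁
      - ((dirDeriv eX (dirDeriv eX η) b + 2 * y₀₁ * dirDeriv eX (dirDeriv (eU 0) η) b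
          + y₀₁ ^ 2 * dirDeriv (eU 0) (dirDeriv (eU 0) η) b + y₀₂ * dirDeriv (eU 0) η b)
        - (dirDeriv eX (dirDeriv eX τ) b + 2 * y₀₁ * dirDeriv eX (dirDeriv (eU 0) τ) b
          + y₀₁ ^ 2 * dirDeriv (eU 0) (dirDeriv (eU 0) τ) b + y₀₂ * dirDeriv (eU 0) τ b) * y₁₀
        - (dirDeriv eX (dirDeriv eX ξ) b + 2 * y₀₁ * dirDeriv eX (dirDeriv (eU 0) ξ) b
          + y₀₁ ^ 2 * dirDeriv (eU 0) (dirDeriv (eU 0) ξ) b + y₀₂ * dirDeriv (eU 0) ξ b) * y₀₁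
        - 2 * (dirDeriv eX τ b + y₀₁ * dirDeriv (eU 0) τ b) * y₁₁
        - 2 * (dirDeriv eX ξ b + y₀₁ * dirDeriv (eU 0) ξ b) * y₀₂) := by
  obtain rfl : Q = fun b => (τ b, ξ b, fun _ => η b) := funext hQ
  subst h10 h01 h11 h02 hp
  have sτ := hτ.smoothAt hΩ hb
  have sξ := hξ.smoothAt hΩ hb
  have sη := hη.smoothAt hΩ hb
  set W : Jet (Fin 1) := (0, 1, fun i j k => p.2.2 i j (k + 1)) with hW
  have h1 : prolongCoeff (fun b => (τ b, ξ b, fun _ => η b)) (0 : Fin 1) 0 1 = fun q =>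
      totalX (fun q => η (jetBase q)) q - totalX (fun q => τ (jetBase q)) q * q.2.2 0 1 0
        - totalX (fun q => ξ (jetBase q)) q * q.2.2 0 0 1 := by
    funext q
    simp only [prolongCoeff]
  have h2 := (((hasDerivAt_totalX_comp_jetBase hΩ hη hb).sub
    ((hasDerivAt_totalX_comp_jetBase hΩ hτ hb).mul (hasDerivAt_jetCoord p W 0 1 0))).sub
    ((hasDerivAt_totalX_comp_jetBase hΩ hξ hb).mul (hasDerivAt_jetCoord p W 0 0 1))).deriv
  rw [lineDeriv_potentialEq (by simpa [jetBase] using hx)]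
  simp only [prolongation]
  have h3 := (congrArg (fun G => totalX G p) h1).trans h2
  beta_reduce at h3
  rw [prolongCoeff_succ_right (k := 1), h3]
  simp only [prolongCoeff, totalX_comp_jetBase sτ, totalX_comp_jetBase sξ, totalX_comp_jetBase sη,
    totalT_comp_jetBase sτ, totalT_comp_jetBase sξ, totalT_comp_jetBase sη]
  simp only [zero_smul, add_zero, totalX_comp_jetBase sτ, totalX_comp_jetBase sξ, hW]
  simp [jetBase]
  ring

lemma lineDeriv_potentialSystem_zero (p W : Jet (Fin 2)) :
    lineDeriv ℝ (potentialSystem densityX fluxX 0) p W =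
      W.2.2 1 0 1 - (W.2.1 * p.2.2 0 0 0 + p.2.1 * W.2.2 0 0 0) := by
  have hX : HasDerivAt (fun s : ℝ => (p + s • W).2.1) W.2.1 0 := by
    simpa using ((hasDerivAt_id (0 : ℝ)).mul_const W.2.1).const_add p.2.1
  have h := (hasDerivAt_jetCoord p W 1 0 1).sub (hX.mul (hasDerivAt_jetCoord p W 0 0 0))
  refine h.deriv.trans ?_
  simp

lemma lineDeriv_potentialSystem_one (p W : Jet (Fin 2)) :
    lineDeriv ℝ (potentialSystem densityX fluxX 1) p W =
      W.2.2 1 1 0 + (W.2.2 0 0 0 - (W.2.1 * p.2.2 0 0 1 + p.2.1 * W.2.2 0 0 1)) := by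
  have hX : HasDerivAt (fun s : ℝ => (p + s • W).2.1) W.2.1 0 := by
    simpa using ((hasDerivAt_id (0 : ℝ)).mul_const W.2.1).const_add p.2.1
  have h := (hasDerivAt_jetCoord p W 1 1 0).add
    ((hasDerivAt_jetCoord p W 0 0 0).sub (hX.mul (hasDerivAt_jetCoord p W 0 0 1)))
  refine h.deriv.trans ?_
  simp

/-- The left-hand sides of the invariance conditions for the potential system, written out:
`y₁₀`, `y₀₁` are the values of `u_t`, `u_x`, and `z₁₀`, `z₀₁` those of `v_t`, `v_x`. -/
lemma lineDeriv_potentialSystem_prolongation {Q : Base (Fin 2) → Base (Fin 2)}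
    {τ ξ φ η : Base (Fin 2) → ℝ} (hQ : ∀ b, Q b = (τ b, ξ b, ![φ b, η b]))
    {b : Base (Fin 2)} (hτ : ContDiffAt ℝ ∞ τ b) (hξ : ContDiffAt ℝ ∞ ξ b)
    (hφ : ContDiffAt ℝ ∞ φ b) (hη : ContDiffAt ℝ ∞ η b)
    {p : Jet (Fin 2)} (hp : jetBase p = b) {y₁₀ y₀₁ z₁₀ z₀₁ : ℝ}
    (h10 : p.2.2 0 1 0 = y₁₀) (h01 : p.2.2 0 0 1 = y₀₁)
    (k10 : p.2.2 1 1 0 = z₁₀) (k01 : p.2.2 1 0 1 = z₀₁) :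
    lineDeriv ℝ (potentialSystem densityX fluxX 0) p (prolongation Q p) =
      (dirDeriv eX η b + y₀₁ * dirDeriv (eU 0) η b + z₀₁ * dirDeriv (eU 1) η b
        - (dirDeriv eX τ b + y₀₁ * dirDeriv (eU 0) τ b + z₀₁ * dirDeriv (eU 1) τ b) * z₁₀
        - (dirDeriv eX ξ b + y₀₁ * dirDeriv (eU 0) ξ b + z₀₁ * dirDeriv (eU 1) ξ b) * z₀₁)
      - ξ b * b.2.2 0 - b.2.1 * φ b ∧
    lineDeriv ℝ (potentialSystem densityX fluxX 1) p (prolongation Q p) =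
      (dirDeriv eT η b + y₁₀ * dirDeriv (eU 0) η b + z₁₀ * dirDeriv (eU 1) η b
        - (dirDeriv eT τ b + y₁₀ * dirDeriv (eU 0) τ b + z₁₀ * dirDeriv (eU 1) τ b) * z₁₀
        - (dirDeriv eT ξ b + y₁₀ * dirDeriv (eU 0) ξ b + z₁₀ * dirDeriv (eU 1) ξ b) * z₀₁)
      + φ b - ξ b * y₀₁
      - b.2.1 * (dirDeriv eX φ b + y₀₁ * dirDeriv (eU 0) φ b + z₀₁ * dirDeriv (eU 1) φ b
        - (dirDeriv eX τ b + y₀₁ * dirDeriv (eU 0) τ b + z₀₁ * dirDeriv (eU 1) τ b) * y₁₀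
        - (dirDeriv eX ξ b + y₀₁ * dirDeriv (eU 0) ξ b + z₀₁ * dirDeriv (eU 1) ξ b) * y₀₁) := by
  obtain rfl : Q = fun b => (τ b, ξ b, ![φ b, η b]) := funext hQ
  subst h10 h01 k10 k01 hp
  rw [lineDeriv_potentialSystem_zero, lineDeriv_potentialSystem_one]
  simp only [prolongation, prolongCoeff, Matrix.cons_val_zero, Matrix.cons_val_one,
    totalX_comp_jetBase hτ, totalX_comp_jetBase hξ, totalX_comp_jetBase hφ,
    totalX_comp_jetBase hη, totalT_comp_jetBase hτ, totalT_comp_jetBase hξ,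
    totalT_comp_jetBase hη, Fin.sum_univ_two]
  constructor <;> simp only [jetBase] <;> ring

lemma hasCharacteristic_heatEq : HasCharacteristic heatEq densityX fluxX charX := by
  intro p
  have hX : ∀ W : Jet (Fin 1), HasDerivAt (fun s : ℝ => (p + s • W).2.1) W.2.1 0 := fun W => by
    simpa using ((hasDerivAt_id (0 : ℝ)).mul_const W.2.1).const_add p.2.1
  have h1 : totalT densityX p = _ :=
    ((hX (1, 0, fun i j k => p.2.2 i (j + 1) k)).mul (hasDerivAt_jetCoord p _ 0 0 0)).deriv
  have h2 : totalX fluxX p = _ :=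
    ((hasDerivAt_jetCoord p (0, 1, fun i j k => p.2.2 i j (k + 1)) 0 0 0).sub
      ((hX _).mul (hasDerivAt_jetCoord p _ 0 0 1))).deriv
  rw [h1, h2]
  simp [charX, heatEq]
  ring

/-! ### Solutions of the potential equation -/

section Solutions

variable {D : Set (ℝ × ℝ)} {f g : ℝ × ℝ → ℝ}

lemma isSolutionOn_potentialEq_iff (hDx : ∀ z ∈ D, z.2 ≠ 0) :
    IsSolutionOn D potentialEq f ↔ ContDiffOn ℝ ∞ f D ∧ ∀ z ∈ D,
      z.2 * partialT f z + 2 * partialX f z - z.2 * partialX (partialX f) z = 0 := by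
  refine and_congr_right fun _ => forall₂_congr fun z hz => ?_
  have hx := hDx z hz
  have : potentialEq (jetOf f z) =
      partialT f z + 2 / z.2 * partialX f z - partialX (partialX f) z := rfl
  rw [this]
  constructor
  · intro h
    field_simp at h
    linear_combination h
  · intro h
    field_simp
    linear_combination h

lemma IsSolutionOn.add (hD : IsOpen D) (hDx : ∀ z ∈ D, z.2 ≠ 0)
    (hf : IsSolutionOn D potentialEq f) (hg : IsSolutionOn D potentialEq g) :
    IsSolutionOn D potentialEq (fun z => f z + g z) := by
  rw [isSolutionOn_potentialEq_iff hDx] at *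
  refine ⟨hf.1.add hg.1, fun z hz => ?_⟩
  have h1 : ∀ z ∈ D, partialX (fun z => f z + g z) z = partialX f z + partialX g z :=
    fun z hz => dirDeriv_add (hf.1.smoothAt hD hz) (hg.1.smoothAt hD hz)
  have h2 : partialT (fun z => f z + g z) z = partialT f z + partialT g z :=
    dirDeriv_add (hf.1.smoothAt hD hz) (hg.1.smoothAt hD hz)
  have h3 : partialX (fun z => partialX f z + partialX g z) z =
      partialX (partialX f) z + partialX (partialX g) z :=
    dirDeriv_add (hf.1.smoothAt hD hz).dirDeriv (hg.1.smoothAt hD hz).dirDeriv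
  rw [h1 z hz, h2, partialX_congr hD h1 z hz, h3]
  linear_combination hf.2 z hz + hg.2 z hz

lemma IsSolutionOn.const_mul (hD : IsOpen D) (hDx : ∀ z ∈ D, z.2 ≠ 0)
    (hf : IsSolutionOn D potentialEq f) (a : ℝ) :
    IsSolutionOn D potentialEq (fun z => a * f z) := by
  rw [isSolutionOn_potentialEq_iff hDx] at *
  refine ⟨contDiffOn_const.mul hf.1, fun z hz => ?_⟩
  have key : ∀ (w z : ℝ × ℝ) {F : ℝ × ℝ → ℝ}, ContDiffAt ℝ ∞ F z →
      dirDeriv w (fun z => a * F z) z = a * dirDeriv w F z := fun w z F hF => by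
    simp [dirDeriv_mul contDiffAt_const hF, dirDeriv_const]
  have h1 : ∀ z ∈ D, partialX (fun z => a * f z) z = a * partialX f z :=
    fun z hz => key _ _ (hf.1.smoothAt hD hz)
  have h2 : partialT (fun z => a * f z) z = a * partialT f z := key _ _ (hf.1.smoothAt hD hz)
  have h3 : partialX (fun z => a * partialX f z) z = a * partialX (partialX f) z :=
    key _ _ (hf.1.smoothAt hD hz).dirDeriv
  rw [h1 z hz, h2, partialX_congr hD h1 z hz, h3]
  linear_combination a * hf.2 z hz

lemma isSolutionOn_zero : IsSolutionOn D potentialEq (fun _ => 0) := by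
  have h : partialX (fun _ => (0 : ℝ)) = fun _ => 0 := by
    ext; simp [partialX, lineDeriv]
  have h' : partialT (fun _ => (0 : ℝ)) = fun _ => 0 := by
    ext; simp [partialT, lineDeriv]
  refine ⟨contDiffOn_const, fun z hz => ?_⟩
  simp [potentialEq, jetOf, h, h']

/-- The coefficient of `∂_t` in the linear combination, with coefficients `c`, of the four
generators without a free function of `𝔱₀` or of `𝔱₁`. -/
noncomputable def coeffT (c : Fin 4 → ℝ) (t : ℝ) : ℝ := c 0 + 2 * c 1 * t + 4 * c 2 * t ^ 2

/-- The coefficient of `∂_x` in this linear combination. -/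
noncomputable def coeffX (c : Fin 4 → ℝ) (t x : ℝ) : ℝ := c 1 * x + 4 * c 2 * t * x

/-- The factor of `v` in the coefficient of `∂_v` in this linear combination. -/
noncomputable def coeffV (c : Fin 4 → ℝ) (t x : ℝ) : ℝ := c 3 - c 2 * (x ^ 2 - 2 * t)

/-- The action of the point symmetries on functions of `(t, x)`; up to the sign, it is the
evolutionary form of the operator `τ ∂_t + ξ ∂_x + A v ∂_v`. -/
noncomputable def symmetryAction (c : Fin 4 → ℝ) (f : ℝ × ℝ → ℝ) (z : ℝ × ℝ) : ℝ :=
  coeffT c z.1 * partialT f z + coeffX c z.1 z.2 * partialX f z - coeffV c z.1 z.2 * f z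

lemma ContDiffOn.symmetryAction (hD : IsOpen D) (hf : ContDiffOn ℝ ∞ f D) (c : Fin 4 → ℝ) :
    ContDiffOn ℝ ∞ (symmetryAction c f) D := fun z hz => by
  have := hf.smoothAt hD hz
  refine ContDiffAt.contDiffWithinAt ?_
  unfold _root_.symmetryAction coeffT coeffX coeffV
  rw [partialT_eq_dirDeriv, partialX_eq_dirDeriv]
  fun_prop

lemma partialX_symmetryAction (hD : IsOpen D) (hf : ContDiffOn ℝ ∞ f D) (c : Fin 4 → ℝ)
    {z : ℝ × ℝ} (hz : z ∈ D) :
    partialX (symmetryAction c f) z = coeffT c z.1 * partialT (partialX f) z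
      + coeffX c z.1 z.2 * partialX (partialX f) z + (c 1 + 4 * c 2 * z.1) * partialX f z
      - coeffV c z.1 z.2 * partialX f z + 2 * c 2 * z.2 * f z := by
  have hs := hf.smoothAt hD hz
  rw [← partialX_partialT hD hf hz]
  unfold symmetryAction coeffT coeffX coeffV
  rw [partialT_eq_dirDeriv, partialX_eq_dirDeriv]
  simp (disch := fun_prop) only [dirDeriv_add, dirDeriv_sub, dirDeriv_mul, dirDeriv_pow,
    dirDeriv_coordT, dirDeriv_coordX, dirDeriv_const]
  push_cast
  ring

/-- The point symmetries of the potential equation map solutions to solutions. -/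
lemma IsSolutionOn.symmetryAction (hD : IsOpen D) (hDx : ∀ z ∈ D, z.2 ≠ 0)
    (hf : IsSolutionOn D potentialEq f) (c : Fin 4 → ℝ) :
    IsSolutionOn D potentialEq (symmetryAction c f) := by
  rw [isSolutionOn_potentialEq_iff hDx] at *
  obtain ⟨hf, hL⟩ := hf
  refine ⟨hf.symmetryAction hD c, fun z hz => ?_⟩
  have hs := hf.smoothAt hD hz
  rw [partialX_congr hD (fun z hz => partialX_symmetryAction hD hf c hz) z hz,
    partialX_symmetryAction hD hf c hz]
  have hLt := partialT_congr_zero hD hL z hz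
  have hLx := partialX_congr_zero hD hL z hz
  have c1 := partialX_partialT hD hf hz
  have c2 := partialX_partialT hD (smooth_partialX hD hf) hz
  unfold _root_.symmetryAction coeffT coeffX coeffV
  rw [partialT_eq_dirDeriv, partialX_eq_dirDeriv] at *
  simp (disch := fun_prop) only [dirDeriv_add, dirDeriv_sub, dirDeriv_mul, dirDeriv_pow,
    dirDeriv_coordT, dirDeriv_coordX, dirDeriv_const] at hLt hLx ⊢
  push_cast
  have hL := hL z hz
  linear_combination (c 0 + 2 * c 1 * z.1 + 4 * c 2 * z.1 ^ 2) * (hLt - z.2 * c2)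
    + (c 1 * z.2 + 4 * c 2 * z.1 * z.2) * (hLx - z.2 * c1)
    + (c 1 + 2 * c 2 * z.1 - c 3 + c 2 * z.2 ^ 2) * hL

end Solutions

/-! ### Lie brackets and restrictions to the fibres -/

section Fields

variable {ι : Type} [Fintype ι]

/-- The coefficients of the Lie bracket: `[Q, R]^a = Q(R^a) - R(Q^a)`. -/
lemma lieBracket_coeff {Q R : Base ι → Base ι} {b : Base ι} (hQ : ContDiffAt ℝ ∞ Q b)
    (hR : ContDiffAt ℝ ∞ R b) :
    (VectorField.lieBracket ℝ Q R b).1 =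
      dirDeriv (Q b) (fun q => (R q).1) b - dirDeriv (R b) (fun q => (Q q).1) b ∧
    (VectorField.lieBracket ℝ Q R b).2.1 =
      dirDeriv (Q b) (fun q => (R q).2.1) b - dirDeriv (R b) (fun q => (Q q).2.1) b ∧
    ∀ i, (VectorField.lieBracket ℝ Q R b).2.2 i =
      dirDeriv (Q b) (fun q => (R q).2.2 i) b - dirDeriv (R b) (fun q => (Q q).2.2 i) b := by
  have key : ∀ (l : Base ι →L[ℝ] ℝ), l (VectorField.lieBracket ℝ Q R b) =
      dirDeriv (Q b) (fun q => l (R q)) b - dirDeriv (R b) (fun q => l (Q q)) b := by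
    intro l
    have hQ' := hQ.differentiableAt (by simp)
    have hR' := hR.differentiableAt (by simp)
    have h : ∀ {S : Base ι → Base ι} (w : Base ι), DifferentiableAt ℝ S b →
        dirDeriv w (fun q => l (S q)) b = l (fderiv ℝ S b w) := fun {S} w hS => by
      have h1 : HasFDerivAt (fun q => l (S q)) (l.comp (fderiv ℝ S b)) b :=
        l.hasFDerivAt.comp b hS.hasFDerivAt
      rw [dirDeriv_eq_fderiv h1.differentiableAt, h1.fderiv]
      rfl
    rw [h _ hQ', h _ hR']
    simp [VectorField.lieBracket]
  refine ⟨key (.fst ℝ _ _), key ((ContinuousLinearMap.fst ℝ ℝ (ι → ℝ)).comp (.snd ℝ _ _)),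
    fun i => key (((ContinuousLinearMap.proj (R := ℝ) i).comp
      (ContinuousLinearMap.snd ℝ ℝ (ι → ℝ))).comp (.snd ℝ _ _))⟩

/-- A function with vanishing derivatives in the dependent variables is constant on the
convex fibres. -/
lemma eq_of_dirDeriv_eU_eq_zero [DecidableEq ι] {Ω : Set (Base ι)} (hΩ : IsOpen Ω)
    {F : Base ι → ℝ} (hF : ContDiffOn ℝ ∞ F Ω)
    (h : ∀ i, ∀ b ∈ Ω, dirDeriv (eU i) F b = 0) {t x : ℝ} {u u' : ι → ℝ}
    (hseg : ∀ r ∈ segment ℝ u u', (t, x, r) ∈ Ω) : F (t, x, u) = F (t, x, u') := by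
  have hmem : ∀ r ∈ segment ℝ ((t, x, u) : Base ι) (t, x, u'), r ∈ Ω := by
    intro r hr
    rw [segment_eq_image'] at hr
    obtain ⟨s, hs, rfl⟩ := hr
    have := hseg (u + s • (u' - u)) (by rw [segment_eq_image']; exact ⟨s, hs, rfl⟩)
    simpa using this
  refine eq_of_dirDeriv_eq_zero (fun r hr => (hF.smoothAt hΩ (hmem r hr)).diffAt) fun r hr => ?_
  rw [dirDeriv_eq_sum (hF.smoothAt hΩ (hmem r hr))]
  simp [h _ r (hmem r hr)]

variable {c : Fin 4 → ℝ} {w b : Base ι}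

lemma dirDeriv_coeffT :
    dirDeriv w (fun q => coeffT c q.1) b = w.1 * (2 * c 1 + 8 * c 2 * b.1) := by
  unfold coeffT
  simp (disch := fun_prop) only [dirDeriv_add, dirDeriv_mul, dirDeriv_pow, dirDeriv_const,
    dirDeriv_baseT]
  push_cast
  ring

lemma dirDeriv_coeffX : dirDeriv w (fun q => coeffX c q.1 q.2.1) b =
    w.1 * (4 * c 2 * b.2.1) + w.2.1 * (c 1 + 4 * c 2 * b.1) := by
  unfold coeffX
  simp (disch := fun_prop) only [dirDeriv_add, dirDeriv_mul, dirDeriv_const, dirDeriv_baseT,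
    dirDeriv_baseX]
  ring

lemma dirDeriv_comp_baseTX_eq {f : ℝ × ℝ → ℝ} (hf : ContDiffAt ℝ ∞ f (b.1, b.2.1)) :
    dirDeriv w (fun q => f (q.1, q.2.1)) b =
      w.1 * partialT f (b.1, b.2.1) + w.2.1 * partialX f (b.1, b.2.1) := by
  rw [dirDeriv_comp_baseTX, partialT_eq_dirDeriv, partialX_eq_dirDeriv,
    dirDeriv_eq_fderiv hf.diffAt, dirDeriv_eq_fderiv hf.diffAt, dirDeriv_eq_fderiv hf.diffAt,
    ← smul_eq_mul, ← smul_eq_mul, ← map_smul, ← map_smul, ← map_add]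
  simp

lemma dirDeriv_coeffV {f : ℝ × ℝ → ℝ} (hf : ContDiffAt ℝ ∞ f (b.1, b.2.1)) (i : ι) :
    dirDeriv w (fun q => coeffV c q.1 q.2.1 * q.2.2 i + f (q.1, q.2.1)) b =
      w.1 * (2 * c 2 * b.2.2 i) - w.2.1 * (2 * c 2 * b.2.1 * b.2.2 i)
      + coeffV c b.1 b.2.1 * w.2.2 i
      + (w.1 * partialT f (b.1, b.2.1) + w.2.1 * partialX f (b.1, b.2.1)) := by
  have hF : ContDiffAt ℝ ∞ (fun b : Base ι => f (b.1, b.2.1)) b := hf.comp b (by fun_prop)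
  have h := dirDeriv_comp_baseTX_eq (w := w) hf
  unfold coeffV
  simp (disch := first | assumption | fun_prop) only [dirDeriv_add, dirDeriv_sub, dirDeriv_mul,
    dirDeriv_pow, dirDeriv_const, dirDeriv_baseT, dirDeriv_baseX, dirDeriv_baseU, h]
  push_cast
  ring

end Fields

/-! ### The potential equation -/

section Equation

variable {D : Set (ℝ × ℝ)} {J : Set ℝ}

lemma isOpen_eqDomain (hD : IsOpen D) (hJ : IsOpen J) : IsOpen (eqDomain D J) :=
  (hD.preimage (by fun_prop : Continuous fun p : Base (Fin 1) => (p.1, p.2.1))).inter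
    (hJ.preimage (by fun_prop : Continuous fun p : Base (Fin 1) => p.2.2 0))

/-- The general element of the algebra `𝔱₀`. -/
noncomputable def eqField (c : Fin 4 → ℝ) (f : ℝ × ℝ → ℝ) (b : Base (Fin 1)) : Base (Fin 1) :=
  (coeffT c b.1, coeffX c b.1 b.2.1,
    fun _ => coeffV c b.1 b.2.1 * b.2.2 0 + f (b.1, b.2.1))

lemma sum_eqOp_add_eqOpOf (c : Fin 4 → ℝ) (f : ℝ × ℝ → ℝ) :
    ∑ i, c i • eqOp i + eqOpOf f = eqField c f := by
  ext b i
  · simp [Fin.sum_univ_four, eqOp, eqOpOf, eqField, coeffT]; ring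
  · simp [Fin.sum_univ_four, eqOp, eqOpOf, eqField, coeffX]; ring
  · simp [Fin.sum_univ_four, eqOp, eqOpOf, eqField, coeffV]; ring

lemma eqField_mem_algT0 {c : Fin 4 → ℝ} {f : ℝ × ℝ → ℝ} (hf : IsSolutionOn D potentialEq f) :
    eqField c f ∈ algT0 D := by
  rw [← sum_eqOp_add_eqOpOf]
  exact Submodule.add_mem _
    (Submodule.sum_mem _ fun i _ => Submodule.smul_mem _ _ (Submodule.subset_span (.inl ⟨i, rfl⟩)))
    (Submodule.subset_span (.inr ⟨f, hf, rfl⟩))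

lemma exists_eq_eqField_of_mem_algT0 (hD : IsOpen D) (hDx : ∀ z ∈ D, z.2 ≠ 0)
    {R : Base (Fin 1) → Base (Fin 1)} (hR : R ∈ algT0 D) :
    ∃ c f, IsSolutionOn D potentialEq f ∧ R = eqField c f := by
  induction hR using Submodule.span_induction with
  | mem R hR =>
    rcases hR with ⟨i, rfl⟩ | ⟨f, hf, rfl⟩
    · refine ⟨Pi.single i 1, fun _ => 0, isSolutionOn_zero, ?_⟩
      rw [← sum_eqOp_add_eqOpOf]
      ext b j <;> simp [Pi.single_apply, ite_smul, eqOpOf]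
    · refine ⟨0, f, hf, ?_⟩
      rw [← sum_eqOp_add_eqOpOf]
      simp
  | zero =>
    refine ⟨0, fun _ => 0, isSolutionOn_zero, ?_⟩
    ext b j <;> simp [eqField, coeffT, coeffX, coeffV]
  | add R S _ _ hR hS =>
    obtain ⟨c, f, hf, rfl⟩ := hR
    obtain ⟨d, g, hg, rfl⟩ := hS
    refine ⟨c + d, _, hf.add hD hDx hg, ?_⟩
    ext b j <;> simp [eqField, coeffT, coeffX, coeffV] <;> ring
  | smul a R _ hR =>
    obtain ⟨c, f, hf, rfl⟩ := hR
    refine ⟨a • c, _, hf.const_mul hD hDx a, ?_⟩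
    ext b j <;> simp [eqField, coeffT, coeffX, coeffV] <;> ring

/-- A jet of one function over the point `b`, with prescribed first and second derivatives. -/
def eqJet (b : Base (Fin 1)) (y₁₀ y₀₁ y₁₁ y₀₂ : ℝ) : Jet (Fin 1) :=
  (b.1, b.2.1, fun i j k => match j, k with
    | 0, 0 => b.2.2 i
    | 1, 0 => y₁₀
    | 0, 1 => y₀₁
    | 1, 1 => y₁₁
    | 0, 2 => y₀₂
    | _, _ => 0)

/-- Every symmetry operator of the potential equation is in the algebra `𝔱₀`: the invariance
condition is split with respect to the derivatives of `v`. -/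
theorem exists_eqField_of_isLieSymmetryOperator (hD : IsOpen D) (hDc : IsConnected D)
    (hDx : ∀ z ∈ D, z.2 ≠ 0) (hJ : IsOpen J) (hJc : IsConnected J)
    {Q : Base (Fin 1) → Base (Fin 1)}
    (hQ : IsLieSymmetryOperator (eqDomain D J) (fun _ : Unit => potentialEq) Q) :
    ∃ c f, IsSolutionOn D potentialEq f ∧ Set.EqOn Q (eqField c f) (eqDomain D J) := by
  obtain ⟨hQs, hinv⟩ := hQ
  have hΩ := isOpen_eqDomain hD hJ
  set Ω := eqDomain D J with hΩdef
  obtain ⟨τ, hτdef⟩ : ∃ τ : Base (Fin 1) → ℝ, τ = fun b => (Q b).1 := ⟨_, rfl⟩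
  obtain ⟨ξ, hξdef⟩ : ∃ ξ : Base (Fin 1) → ℝ, ξ = fun b => (Q b).2.1 := ⟨_, rfl⟩
  obtain ⟨η, hηdef⟩ : ∃ η : Base (Fin 1) → ℝ, η = fun b => (Q b).2.2 0 := ⟨_, rfl⟩
  have hQeq : ∀ b, Q b = (τ b, ξ b, fun _ => η b) := fun b => by
    ext i
    · simp [hτdef]
    · simp [hξdef]
    · simp [hηdef, Subsingleton.elim i 0]
  have hτ : ContDiffOn ℝ ∞ τ Ω := by rw [hτdef]; fun_prop
  have hξ : ContDiffOn ℝ ∞ ξ Ω := by rw [hξdef]; fun_prop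
  have hη : ContDiffOn ℝ ∞ η Ω := by rw [hηdef]; fun_prop
  have hx : ∀ b ∈ Ω, b.2.1 ≠ 0 := fun b hb => hDx (b.1, b.2.1) hb.1
  -- the invariance condition at the jets with `v_t = v_xx - (2 / x) v_x`
  have hE : ∀ b ∈ Ω, ∀ y₀₁ y₁₁ y₀₂ : ℝ, _ = (0 : ℝ) := fun b hb y₀₁ y₁₁ y₀₂ =>
    (lineDeriv_potentialEq_prolongation hΩ hQeq hτ hξ hη hb (hx b hb)
      (p := eqJet b (y₀₂ - 2 / b.2.1 * y₀₁) y₀₁ y₁₁ y₀₂) (y₁₀ := y₀₂ - 2 / b.2.1 * y₀₁)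
      (y₀₁ := y₀₁) (y₁₁ := y₁₁) (y₀₂ := y₀₂) rfl rfl rfl rfl rfl).symm.trans
      (hinv (eqJet b (y₀₂ - 2 / b.2.1 * y₀₁) y₀₁ y₁₁ y₀₂) hb
        (fun _ => by simp [potentialEq, eqJet]) ())
  -- the coefficients of `v_tx`
  have τx : ∀ b ∈ Ω, dirDeriv eX τ b = 0 := fun b hb => by
    linear_combination (hE b hb 0 1 0 - hE b hb 0 0 0) / 2
  have τv : ∀ b ∈ Ω, dirDeriv (eU 0) τ b = 0 := fun b hb => by
    linear_combination (hE b hb 1 1 0 - hE b hb 1 0 0) / 2 - τx b hb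
  have zero_of : ∀ {F : Base (Fin 1) → ℝ}, (∀ b ∈ Ω, F b = 0) → ∀ w, ∀ b ∈ Ω,
      dirDeriv w F b = 0 := fun {F} h w b hb => by
    rw [dirDeriv_congr hΩ (G := fun _ => 0) h hb, dirDeriv_const]
  have τxx := zero_of τx eX
  have τvx := zero_of τv eX
  have τvv := zero_of τv (eU 0)
  -- the coefficients of `v_xx`
  have ξx : ∀ b ∈ Ω, 2 * dirDeriv eX ξ b = dirDeriv eT τ b := fun b hb => by
    have h1 := hE b hb 0 0 1
    have h0 := hE b hb 0 0 0
    rw [τx b hb, τv b hb, τxx b hb, τvx b hb, τvv b hb] at h1 h0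
    linear_combination h1 - h0
  have ξv : ∀ b ∈ Ω, dirDeriv (eU 0) ξ b = 0 := fun b hb => by
    have h1 := hE b hb 1 0 1
    have h0 := hE b hb 1 0 0
    rw [τx b hb, τv b hb, τxx b hb, τvx b hb, τvv b hb] at h1 h0
    linear_combination (h1 - h0 - ξx b hb) / 2
  have ξvx := zero_of ξv eX
  have ξvv := zero_of ξv (eU 0)
  have ξxx : ∀ b ∈ Ω, dirDeriv eX (dirDeriv eX ξ) b = 0 := fun b hb => by
    have := hξ.smoothAt hΩ hb
    have h1 := dirDeriv_congr (w := eX) hΩ ξx hb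
    rw [dirDeriv_comm (hτ.smoothAt hΩ hb), zero_of τx eT b hb] at h1
    simp (disch := fun_prop) only [dirDeriv_mul, dirDeriv_const] at h1
    linear_combination h1 / 2
  -- what remains is a quadratic polynomial in `v_x`
  have hE' : ∀ b ∈ Ω, ∀ y : ℝ, b.2.1 ^ 2 * dirDeriv eT η b + 2 * b.2.1 * dirDeriv eX η b
      - b.2.1 ^ 2 * dirDeriv eX (dirDeriv eX η) b
      + (b.2.1 * dirDeriv eT τ b - b.2.1 ^ 2 * dirDeriv eT ξ b - 2 * ξ b
        - 2 * b.2.1 ^ 2 * dirDeriv eX (dirDeriv (eU 0) η) b) * y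
      - b.2.1 ^ 2 * dirDeriv (eU 0) (dirDeriv (eU 0) η) b * y ^ 2 = 0 := fun b hb y => by
    have h := hE b hb y 0 0
    have h0 := hx b hb
    rw [τx b hb, τv b hb, τxx b hb, τvx b hb, τvv b hb, ξv b hb, ξvx b hb, ξvv b hb,
      ξxx b hb] at h
    field_simp at h
    linear_combination h + y * b.2.1 * ξx b hb
  have e1 : ∀ b ∈ Ω, b.2.1 * dirDeriv eT η b + 2 * dirDeriv eX η b
      - b.2.1 * dirDeriv eX (dirDeriv eX η) b = 0 := fun b hb =>
    mul_left_cancel₀ (hx b hb) (by linear_combination hE' b hb 0)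
  have e2 : ∀ b ∈ Ω, b.2.1 ^ 2 * (2 * dirDeriv eX (dirDeriv (eU 0) η) b + dirDeriv eT ξ b)
      + 2 * ξ b - b.2.1 * dirDeriv eT τ b = 0 := fun b hb => by
    linear_combination (hE' b hb (-1) - hE' b hb 1) / 2
  have ηvv : ∀ b ∈ Ω, dirDeriv (eU 0) (dirDeriv (eU 0) η) b = 0 := fun b hb =>
    mul_left_cancel₀ (pow_ne_zero 2 (hx b hb))
      (by linear_combination (2 * hE' b hb 0 - hE' b hb (-1) - hE' b hb 1) / 2)
  have e3 : ∀ b ∈ Ω, b.2.1 * dirDeriv eT (dirDeriv (eU 0) η) b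
      + 2 * dirDeriv eX (dirDeriv (eU 0) η) b
      - b.2.1 * dirDeriv eX (dirDeriv eX (dirDeriv (eU 0) η)) b = 0 := fun b hb => by
    have h := zero_of e1 (eU 0) b hb
    have hs := hη.smoothAt hΩ hb
    simp (disch := fun_prop) only [dirDeriv_add, dirDeriv_sub, dirDeriv_mul, dirDeriv_const,
      dirDeriv_baseX] at h
    rw [dirDeriv_comm (w' := eT) hs, dirDeriv_comm (w' := eX) hs,
      dirDeriv_comm (w' := eX) hs.dirDeriv,
      dirDeriv_congr (w := eX) hΩ (fun q hq => dirDeriv_comm (hη.smoothAt hΩ hq)) hb] at h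
    linear_combination h
  -- restriction to a plane `v = const`
  obtain ⟨v₀, hv₀⟩ := hJc.nonempty
  have hmem : ∀ z ∈ D, ((z.1, z.2, fun _ => v₀) : Base (Fin 1)) ∈ Ω := fun z hz => ⟨hz, hv₀⟩
  have hres : ∀ {F : Base (Fin 1) → ℝ}, ContDiffOn ℝ ∞ F Ω →
      ContDiffOn ℝ ∞ (fun z : ℝ × ℝ => F (z.1, z.2, fun _ => v₀)) D := fun hF =>
    hF.comp (by fun_prop) hmem
  have hηv : ContDiffOn ℝ ∞ (dirDeriv (eU 0) η) Ω := hη.dirDeriv hΩ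
  have hG : ContDiffOn ℝ ∞ (fun b => η b - dirDeriv (eU 0) η b * b.2.2 0) Ω :=
    hη.sub (hηv.mul (by fun_prop))
  obtain ⟨c, hc⟩ := exists_coeff_of_determining hD hDc hDx (hres hτ) (hres hξ) (hres hηv)
    (fun z hz => by
      rw [partialX_eq_dirDeriv, dirDeriv_restrict]; exact τx _ (hmem z hz))
    (fun z hz => by
      rw [partialX_eq_dirDeriv, partialT_eq_dirDeriv, dirDeriv_restrict, dirDeriv_restrict]
      exact ξx _ (hmem z hz))
    (fun z hz => by
      rw [partialX_eq_dirDeriv, partialT_eq_dirDeriv, dirDeriv_restrict, dirDeriv_restrict,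
        dirDeriv_restrict]
      exact e2 _ (hmem z hz))
    (fun z hz => by
      rw [partialX_eq_dirDeriv, partialT_eq_dirDeriv, dirDeriv_restrict, dirDeriv_restrict,
        dirDeriv_restrict]
      have := e3 _ (hmem z hz)
      linear_combination this)
  -- `η = A v + B` with `A = η_v`, so that `B` is recovered at `v = v₀` as `η - v₀ A`
  have hsolA : IsSolutionOn D potentialEq fun z => dirDeriv (eU 0) η (z.1, z.2, fun _ => v₀) := by
    rw [isSolutionOn_potentialEq_iff hDx, partialX_eq_dirDeriv, partialT_eq_dirDeriv]
    refine ⟨hres hηv, fun z hz => ?_⟩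
    rw [dirDeriv_restrict, dirDeriv_restrict, dirDeriv_restrict]
    exact e3 _ (hmem z hz)
  have hsolη : IsSolutionOn D potentialEq fun z => η (z.1, z.2, fun _ => v₀) := by
    rw [isSolutionOn_potentialEq_iff hDx, partialX_eq_dirDeriv, partialT_eq_dirDeriv]
    refine ⟨hres hη, fun z hz => ?_⟩
    rw [dirDeriv_restrict, dirDeriv_restrict, dirDeriv_restrict]
    exact e1 _ (hmem z hz)
  refine ⟨c, _, hsolη.add hD hDx (hsolA.const_mul hD hDx (-v₀)), ?_⟩
  rintro ⟨t, x, v⟩ hb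
  have hseg : ∀ r ∈ segment ℝ v (fun _ => v₀), ((t, x, r) : Base (Fin 1)) ∈ Ω := by
    intro r hr
    refine ⟨hb.1, ?_⟩
    refine hJc.isPreconnected.convex.segment_subset hb.2 hv₀ ?_
    rw [segment_eq_image'] at hr ⊢
    obtain ⟨s, hs, rfl⟩ := hr
    exact ⟨s, hs, rfl⟩
  have fin1 : ∀ {P : Fin 1 → Prop}, P 0 → ∀ i, P i := fun h i => by
    rwa [Subsingleton.elim i 0]
  have rτ := eq_of_dirDeriv_eU_eq_zero hΩ hτ (fin1 τv) hseg
  have rξ := eq_of_dirDeriv_eU_eq_zero hΩ hξ (fin1 ξv) hseg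
  have rA := eq_of_dirDeriv_eU_eq_zero hΩ hηv (fin1 ηvv) hseg
  have rη := eq_of_dirDeriv_eU_eq_zero hΩ hG (fin1 fun b hb => by
    have hs := hη.smoothAt hΩ hb
    simp (disch := fun_prop) only [dirDeriv_sub, dirDeriv_mul, dirDeriv_baseU]
    rw [ηvv b hb]
    simp) hseg
  obtain ⟨c1, c2, c3⟩ := hc (t, x) hb.1
  rw [hQeq, rτ, rξ, c1, c2]
  refine Prod.ext rfl (Prod.ext rfl (funext fun i => ?_))
  simp only [eqField, coeffV] at *
  linear_combination rη + v 0 * rA + (v 0) * c3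

lemma contDiffOn_eqField {c : Fin 4 → ℝ} {f : ℝ × ℝ → ℝ}
    (hf : ContDiffOn ℝ ∞ f D) : ContDiffOn ℝ ∞ (eqField c f) (eqDomain D J) := by
  have hF : ContDiffOn ℝ ∞ (fun b : Base (Fin 1) => f (b.1, b.2.1)) (eqDomain D J) :=
    hf.comp (by fun_prop) fun b hb => hb.1
  unfold eqField coeffT coeffX coeffV
  exact ContDiffOn.prodMk (by fun_prop) (ContDiffOn.prodMk (by fun_prop)
    (contDiffOn_pi.2 fun i => ContDiffOn.add (by fun_prop) hF))

/-- The elements of the algebra `𝔱₀` satisfy the invariance condition. -/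
theorem isLieSymmetryOperator_of_eqOn_eqField (hD : IsOpen D)
    (hDx : ∀ z ∈ D, z.2 ≠ 0) (hJ : IsOpen J) {c : Fin 4 → ℝ} {f : ℝ × ℝ → ℝ}
    (hf : IsSolutionOn D potentialEq f) {Q : Base (Fin 1) → Base (Fin 1)}
    (hQ : Set.EqOn Q (eqField c f) (eqDomain D J)) :
    IsLieSymmetryOperator (eqDomain D J) (fun _ : Unit => potentialEq) Q := by
  rw [isSolutionOn_potentialEq_iff hDx] at hf
  obtain ⟨hf, hL⟩ := hf
  have hQs : ContDiffOn ℝ ∞ Q (eqDomain D J) := (contDiffOn_eqField hf).congr hQ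
  refine ⟨hQs, fun p hp hsat _ => ?_⟩
  have hsat := hsat ()
  have hΩ := isOpen_eqDomain hD hJ
  set Ω := eqDomain D J with hΩdef
  obtain ⟨τ, hτdef⟩ : ∃ τ : Base (Fin 1) → ℝ, τ = fun b => (Q b).1 := ⟨_, rfl⟩
  obtain ⟨ξ, hξdef⟩ : ∃ ξ : Base (Fin 1) → ℝ, ξ = fun b => (Q b).2.1 := ⟨_, rfl⟩
  obtain ⟨η, hηdef⟩ : ∃ η : Base (Fin 1) → ℝ, η = fun b => (Q b).2.2 0 := ⟨_, rfl⟩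
  have hQeq : ∀ b, Q b = (τ b, ξ b, fun _ => η b) := fun b => by
    ext i
    · simp [hτdef]
    · simp [hξdef]
    · simp [hηdef, Subsingleton.elim i 0]
  have hτ : ContDiffOn ℝ ∞ τ Ω := by rw [hτdef]; fun_prop
  have hξ : ContDiffOn ℝ ∞ ξ Ω := by rw [hξdef]; fun_prop
  have hη : ContDiffOn ℝ ∞ η Ω := by rw [hηdef]; fun_prop
  have sF : ∀ {F : ℝ × ℝ → ℝ}, ContDiffOn ℝ ∞ F D → ∀ b ∈ Ω,
      ContDiffAt ℝ ∞ (fun b : Base (Fin 1) => F (b.1, b.2.1)) b := fun hF b hb =>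
    (hF.smoothAt hD (p := (b.1, b.2.1)) hb.1).comp b (by fun_prop)
  have vτ : ∀ b ∈ Ω, τ b = coeffT c b.1 := fun b hb => by
    rw [hτdef]; simp only [hQ hb]; rfl
  have vξ : ∀ b ∈ Ω, ξ b = coeffX c b.1 b.2.1 := fun b hb => by
    rw [hξdef]; simp only [hQ hb]; rfl
  have vη : ∀ b ∈ Ω, η b = coeffV c b.1 b.2.1 * b.2.2 0 + f (b.1, b.2.1) := fun b hb => by
    rw [hηdef]; simp only [hQ hb]; rfl
  have hd : ∀ {F G : Base (Fin 1) → ℝ}, (∀ b ∈ Ω, F b = G b) → ∀ (w : Base (Fin 1)),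
      ∀ b ∈ Ω, dirDeriv w F b = dirDeriv w G b := fun h w b hb => dirDeriv_congr hΩ h hb
  have dτ : ∀ w : Base (Fin 1), ∀ b ∈ Ω,
      dirDeriv w τ b = w.1 * (2 * c 1 + 8 * c 2 * b.1) := fun w b hb => by
    rw [hd vτ w b hb, dirDeriv_coeffT]
  have dξ : ∀ w : Base (Fin 1), ∀ b ∈ Ω, dirDeriv w ξ b =
      w.1 * (4 * c 2 * b.2.1) + w.2.1 * (c 1 + 4 * c 2 * b.1) := fun w b hb => by
    rw [hd vξ w b hb, dirDeriv_coeffX]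
  have dη : ∀ w : Base (Fin 1), ∀ b ∈ Ω, _ := fun w b hb =>
    (hd vη w b hb).trans (dirDeriv_coeffV (hf.smoothAt hD hb.1) 0)
  have dηx : ∀ b ∈ Ω, dirDeriv eX η b =
      - (2 * c 2 * b.2.1 * b.2.2 0) + partialX f (b.1, b.2.1) := fun b hb => by
    rw [dη eX b hb]
    simp
  have dηv : ∀ b ∈ Ω, dirDeriv (eU 0) η b = c 3 - c 2 * (b.2.1 ^ 2 - 2 * b.1) := fun b hb => by
    rw [dη (eU 0) b hb]
    simp [coeffV]
  have dηxx : ∀ b ∈ Ω, dirDeriv eX (dirDeriv eX η) b =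
      - (2 * c 2 * b.2.2 0) + partialX (partialX f) (b.1, b.2.1) := fun b hb => by
    have := sF (smooth_partialX hD hf) b hb
    rw [hd dηx eX b hb]
    simp (disch := first | assumption | fun_prop) only [dirDeriv_add, dirDeriv_neg, dirDeriv_mul,
      dirDeriv_const, dirDeriv_baseX, dirDeriv_baseU,
      dirDeriv_comp_baseTX]
    rw [partialX_eq_dirDeriv]
    simp
    ring
  have dηxv : ∀ b ∈ Ω, dirDeriv eX (dirDeriv (eU 0) η) b = - (2 * c 2 * b.2.1) := fun b hb => by
    rw [hd dηv eX b hb]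
    simp (disch := fun_prop) only [dirDeriv_sub, dirDeriv_mul,
      dirDeriv_pow, dirDeriv_const, dirDeriv_baseT, dirDeriv_baseX]
    push_cast
    ring
  have dηvv : ∀ b ∈ Ω, dirDeriv (eU 0) (dirDeriv (eU 0) η) b = 0 := fun b hb => by
    rw [hd dηv (eU 0) b hb]
    simp (disch := fun_prop) only [dirDeriv_sub, dirDeriv_mul,
      dirDeriv_pow, dirDeriv_const, dirDeriv_baseT, dirDeriv_baseX]
    ring
  have dτ0 : ∀ w : Base (Fin 1), w.1 = 0 → ∀ b ∈ Ω, dirDeriv w τ b = 0 := fun w hw b hb => by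
    rw [dτ w b hb, hw, zero_mul]
  have ddτ0 : ∀ w w' : Base (Fin 1), w.1 = 0 → ∀ b ∈ Ω, dirDeriv w' (dirDeriv w τ) b = 0 :=
    fun w w' hw b hb => by rw [hd (dτ0 w hw) w' b hb, dirDeriv_const]
  have ddξv : ∀ w' : Base (Fin 1), ∀ b ∈ Ω, dirDeriv w' (dirDeriv (eU 0) ξ) b = 0 :=
    fun w' b hb => by
      rw [hd (G := fun _ => 0) (fun b hb => by simp [dξ (eU 0) b hb]) w' b hb, dirDeriv_const]
  have ddξx : ∀ b ∈ Ω, dirDeriv eX (dirDeriv eX ξ) b = 0 := fun b hb => by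
    rw [hd (G := fun b => c 1 + 4 * c 2 * b.1) (fun b hb => by simp [dξ eX b hb]) eX b hb]
    simp (disch := fun_prop) [dirDeriv_add, dirDeriv_mul, dirDeriv_const, dirDeriv_baseT]
  have hx : (jetBase p).2.1 ≠ 0 := hDx _ hp.1
  rw [lineDeriv_potentialEq_prolongation hΩ hQeq hτ hξ hη hp hx rfl rfl rfl rfl rfl]
  rw [dτ0 eX rfl _ hp, dτ0 (eU 0) rfl _ hp, ddτ0 eX eX rfl _ hp, ddτ0 (eU 0) eX rfl _ hp,
    ddτ0 (eU 0) (eU 0) rfl _ hp, ddξv _ _ hp, ddξv _ _ hp, ddξx _ hp, dηvv _ hp, dηxv _ hp,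
    dηxx _ hp, dηv _ hp, dηx _ hp, dη eT _ hp, dξ eT _ hp, dξ eX _ hp, dξ (eU 0) _ hp, dτ eT _ hp,
    vξ _ hp]
  have hz := hL _ hp.1
  have hsat' : p.2.2 0 1 0 = p.2.2 0 0 2 - 2 / (jetBase p).2.1 * p.2.2 0 0 1 := by
    have : potentialEq p = p.2.2 0 1 0 + 2 / (jetBase p).2.1 * p.2.2 0 0 1 - p.2.2 0 0 2 := rfl
    linear_combination hsat - this
  rw [hsat']
  simp only [coeffX, Pi.zero_apply, zero_mul, mul_zero, add_zero, sub_zero, one_mul, zero_add]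
  field_simp
  linear_combination hz

/-- The algebra `𝔱₀` is closed under the Lie bracket. -/
theorem lieBracket_eqField (hD : IsOpen D) (hJ : IsOpen J)
    {c d : Fin 4 → ℝ} {f g : ℝ × ℝ → ℝ} (hf : ContDiffOn ℝ ∞ f D) (hg : ContDiffOn ℝ ∞ g D) :
    Set.EqOn (VectorField.lieBracket ℝ (eqField c f) (eqField d g))
      (eqField ![2 * (c 0 * d 1 - c 1 * d 0), 4 * (c 0 * d 2 - c 2 * d 0),
          2 * (c 1 * d 2 - c 2 * d 1), 2 * (c 0 * d 2 - c 2 * d 0)]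
        (fun z => symmetryAction c g z + -1 * symmetryAction d f z)) (eqDomain D J) := by
  intro b hb
  have hΩ := isOpen_eqDomain hD hJ
  obtain ⟨h1, h2, h3⟩ := lieBracket_coeff
    ((contDiffOn_eqField (c := c) hf).contDiffAt (hΩ.mem_nhds hb))
    ((contDiffOn_eqField (c := d) hg).contDiffAt (hΩ.mem_nhds hb))
  have h3 := h3 0
  simp only [eqField, dirDeriv_coeffT, dirDeriv_coeffX, dirDeriv_coeffV (hf.smoothAt hD hb.1),
    dirDeriv_coeffV (hg.smoothAt hD hb.1)] at h1 h2 h3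
  refine Prod.ext ?_ (Prod.ext ?_ (funext fun i => ?_))
  · refine h1.trans ?_
    simp only [eqField, coeffT, Matrix.cons_val]
    ring
  · refine h2.trans ?_
    simp only [eqField, coeffT, coeffX, Matrix.cons_val]
    ring
  · rw [Subsingleton.elim i 0]
    refine h3.trans ?_
    simp only [eqField, coeffT, coeffX, coeffV, Matrix.cons_val, symmetryAction]
    ring

theorem isMaximalLieInvarianceAlgebra_algT0 (hD : IsOpen D) (hDc : IsConnected D)
    (hDx : ∀ z ∈ D, z.2 ≠ 0) (hJ : IsOpen J) (hJc : IsConnected J) :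
    IsMaximalLieInvarianceAlgebra (eqDomain D J) (fun _ : Unit => potentialEq) (algT0 D) := by
  refine ⟨fun Q hQ R hR => ?_, fun Q => ⟨fun hQ => ?_, ?_⟩⟩
  · obtain ⟨c, f, hf, rfl⟩ := exists_eq_eqField_of_mem_algT0 hD hDx hQ
    obtain ⟨d, g, hg, rfl⟩ := exists_eq_eqField_of_mem_algT0 hD hDx hR
    exact ⟨_, eqField_mem_algT0 ((hg.symmetryAction hD hDx c).add hD hDx
      ((hf.symmetryAction hD hDx d).const_mul hD hDx (-1))), lieBracket_eqField hD hJ hf.1 hg.1⟩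
  · obtain ⟨c, f, hf, h⟩ := exists_eqField_of_isLieSymmetryOperator hD hDc hDx hJ hJc hQ
    exact ⟨_, eqField_mem_algT0 hf, h⟩
  · rintro ⟨R, hR, h⟩
    obtain ⟨c, f, hf, rfl⟩ := exists_eq_eqField_of_mem_algT0 hD hDx hR
    exact isLieSymmetryOperator_of_eqOn_eqField hD hDx hJ hf h

end Equation

/-! ### The potential system -/

section System

variable {D : Set (ℝ × ℝ)} {I J : Set ℝ}

lemma isOpen_sysDomain (hD : IsOpen D) (hI : IsOpen I) (hJ : IsOpen J) :
    IsOpen (sysDomain D I J) :=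
  (hD.preimage (by fun_prop : Continuous fun p : Base (Fin 2) => (p.1, p.2.1))).inter
    ((hI.preimage (by fun_prop : Continuous fun p : Base (Fin 2) => p.2.2 0)).inter
      (hJ.preimage (by fun_prop : Continuous fun p : Base (Fin 2) => p.2.2 1)))

/-- The coefficient of `∂_u` in the linear combination, with coefficients `c`, of the four
generators without a free function of `𝔱₁`. -/
noncomputable def coeffU (c : Fin 4 → ℝ) (t x u v : ℝ) : ℝ :=
  (c 3 - 2 * c 1) * u - c 2 * ((x ^ 2 + 6 * t) * u + 2 * v)

/-- The general element of the algebra `𝔱₁`. -/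
noncomputable def sysField (c : Fin 4 → ℝ) (f : ℝ × ℝ → ℝ) (b : Base (Fin 2)) : Base (Fin 2) :=
  (coeffT c b.1, coeffX c b.1 b.2.1,
    ![coeffU c b.1 b.2.1 (b.2.2 0) (b.2.2 1) + b.2.1⁻¹ * partialX f (b.1, b.2.1),
      coeffV c b.1 b.2.1 * b.2.2 1 + f (b.1, b.2.1)])

lemma sum_sysOp_add_sysOpOf (c : Fin 4 → ℝ) (f : ℝ × ℝ → ℝ) :
    ∑ i, c i • sysOp i + sysOpOf f = sysField c f := by
  ext b i
  · simp [Fin.sum_univ_four, sysOp, sysOpOf, sysField, coeffT]; ring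
  · simp [Fin.sum_univ_four, sysOp, sysOpOf, sysField, coeffX]; ring
  · fin_cases i
    · simp [Fin.sum_univ_four, sysOp, sysOpOf, sysField, coeffU]; ring
    · simp [Fin.sum_univ_four, sysOp, sysOpOf, sysField, coeffV]; ring

lemma sysField_mem_algT1 {c : Fin 4 → ℝ} {f : ℝ × ℝ → ℝ} (hf : IsSolutionOn D potentialEq f) :
    sysField c f ∈ algT1 D := by
  rw [← sum_sysOp_add_sysOpOf]
  exact Submodule.add_mem _
    (Submodule.sum_mem _ fun i _ => Submodule.smul_mem _ _ (Submodule.subset_span (.inl ⟨i, rfl⟩)))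
    (Submodule.subset_span (.inr ⟨f, hf, rfl⟩))

lemma exists_eqOn_sysField_of_mem_algT1 (hD : IsOpen D) (hDx : ∀ z ∈ D, z.2 ≠ 0)
    {R : Base (Fin 2) → Base (Fin 2)} (hR : R ∈ algT1 D) :
    ∃ c f, IsSolutionOn D potentialEq f ∧ Set.EqOn R (sysField c f) (sysDomain D I J) := by
  induction hR using Submodule.span_induction with
  | mem R hR =>
    rcases hR with ⟨i, rfl⟩ | ⟨f, hf, rfl⟩
    · refine ⟨Pi.single i 1, fun _ => 0, isSolutionOn_zero, fun b _ => congrFun ?_ b⟩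
      have h0 : partialX (fun _ => (0 : ℝ)) = fun _ => 0 := by
        ext; simp [partialX, lineDeriv]
      rw [← sum_sysOp_add_sysOpOf]
      ext b j
      · simp [Pi.single_apply, ite_smul, sysOpOf]
      · simp [Pi.single_apply, ite_smul, sysOpOf]
      · fin_cases j <;> simp [Pi.single_apply, ite_smul, sysOpOf, h0]
    · refine ⟨0, f, hf, fun b _ => congrFun ?_ b⟩
      rw [← sum_sysOp_add_sysOpOf]
      simp
  | zero =>
    refine ⟨0, fun _ => 0, isSolutionOn_zero, fun b _ => ?_⟩
    have h0 : partialX (fun _ => (0 : ℝ)) = fun _ => 0 := by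
      ext; simp [partialX, lineDeriv]
    ext j
    · simp [sysField, coeffT]
    · simp [sysField, coeffX]
    · fin_cases j <;> simp [sysField, coeffU, coeffV, h0]
  | add R S _ _ hR hS =>
    obtain ⟨c, f, hf, hR⟩ := hR
    obtain ⟨d, g, hg, hS⟩ := hS
    refine ⟨c + d, _, hf.add hD hDx hg, fun b hb => ?_⟩
    have h1 : partialX (fun z => f z + g z) (b.1, b.2.1) = _ :=
      dirDeriv_add (hf.1.smoothAt hD hb.1) (hg.1.smoothAt hD hb.1)
    rw [partialX_eq_dirDeriv] at h1
    rw [Pi.add_apply, hR hb, hS hb]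
    ext j
    · simp [sysField, coeffT]; ring
    · simp [sysField, coeffX]; ring
    · fin_cases j
      · simp [sysField, coeffU, h1, partialX_eq_dirDeriv]; ring
      · simp [sysField, coeffV]; ring
  | smul a R _ hR =>
    obtain ⟨c, f, hf, hR⟩ := hR
    refine ⟨a • c, _, hf.const_mul hD hDx a, fun b hb => ?_⟩
    have h1 : partialX (fun z => a * f z) (b.1, b.2.1) = _ :=
      dirDeriv_mul contDiffAt_const (hf.1.smoothAt hD hb.1)
    rw [partialX_eq_dirDeriv] at h1
    rw [Pi.smul_apply, hR hb]
    ext j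
    · simp [sysField, coeffT]; ring
    · simp [sysField, coeffX]; ring
    · fin_cases j
      · simp [sysField, coeffU, h1, partialX_eq_dirDeriv, dirDeriv_const]; ring
      · simp [sysField, coeffV]; ring

lemma smoothAt_inv_mul_partialX (hD : IsOpen D) (hDx : ∀ z ∈ D, z.2 ≠ 0) {f : ℝ × ℝ → ℝ}
    (hf : ContDiffOn ℝ ∞ f D) {b : Base (Fin 2)} (hb : (b.1, b.2.1) ∈ D) :
    ContDiffAt ℝ ∞ (fun b : Base (Fin 2) => b.2.1⁻¹ * partialX f (b.1, b.2.1)) b := by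
  refine ContDiffAt.mul (ContDiffAt.inv (by fun_prop) (hDx _ hb)) ?_
  exact ContDiffAt.comp (f := fun b : Base (Fin 2) => (b.1, b.2.1)) b
    ((smooth_partialX hD hf).smoothAt hD hb) (by fun_prop)

lemma contDiffOn_sysField (hD : IsOpen D) (hDx : ∀ z ∈ D, z.2 ≠ 0) {c : Fin 4 → ℝ}
    {f : ℝ × ℝ → ℝ} (hf : ContDiffOn ℝ ∞ f D) :
    ContDiffOn ℝ ∞ (sysField c f) (sysDomain D I J) := by
  have hF : ContDiffOn ℝ ∞ (fun b : Base (Fin 2) => f (b.1, b.2.1)) (sysDomain D I J) :=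
    hf.comp (by fun_prop) fun b hb => hb.1
  unfold sysField coeffT coeffX coeffU coeffV
  refine ContDiffOn.prodMk (by fun_prop) (ContDiffOn.prodMk (by fun_prop)
    (contDiffOn_pi.2 fun i => ?_))
  fin_cases i
  · exact ContDiffOn.add (by fun_prop) fun b hb =>
      (smoothAt_inv_mul_partialX hD hDx hf hb.1).contDiffWithinAt
  · exact ContDiffOn.add (by fun_prop) hF

lemma dirDeriv_coeffU (hD : IsOpen D) (hDx : ∀ z ∈ D, z.2 ≠ 0) {f : ℝ × ℝ → ℝ}
    (hf : ContDiffOn ℝ ∞ f D) {c : Fin 4 → ℝ} {w b : Base (Fin 2)} (hb : (b.1, b.2.1) ∈ D) :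
    dirDeriv w (fun b => coeffU c b.1 b.2.1 (b.2.2 0) (b.2.2 1)
        + b.2.1⁻¹ * partialX f (b.1, b.2.1)) b =
      (c 3 - 2 * c 1 - c 2 * (b.2.1 ^ 2 + 6 * b.1)) * w.2.2 0 - 2 * c 2 * w.2.2 1
      - (6 * w.1 + 2 * b.2.1 * w.2.1) * c 2 * b.2.2 0
      + b.2.1⁻¹ * (w.1 * partialT (partialX f) (b.1, b.2.1)
        + w.2.1 * partialX (partialX f) (b.1, b.2.1))
      - w.2.1 * partialX f (b.1, b.2.1) / b.2.1 ^ 2 := by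
  have hfx := (smooth_partialX hD hf).smoothAt hD hb
  have hF : ContDiffAt ℝ ∞ (fun b : Base (Fin 2) => partialX f (b.1, b.2.1)) b :=
    ContDiffAt.comp (f := fun b : Base (Fin 2) => (b.1, b.2.1)) b hfx (by fun_prop)
  have hM := smoothAt_inv_mul_partialX hD hDx hf hb
  have hI : ContDiffAt ℝ ∞ (fun b : Base (Fin 2) => b.2.1⁻¹) b :=
    ContDiffAt.inv (by fun_prop) (hDx _ hb)
  have h := dirDeriv_comp_baseTX_eq (w := w) hfx
  have hi : dirDeriv w (fun b : Base (Fin 2) => b.2.1⁻¹) b = -w.2.1 / b.2.1 ^ 2 := by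
    rw [dirDeriv_inv (F := fun b : Base (Fin 2) => b.2.1) (by fun_prop) (hDx _ hb),
      dirDeriv_baseX]
  unfold coeffU
  simp (disch := first | assumption | fun_prop) only [dirDeriv_add, dirDeriv_sub, dirDeriv_mul,
    dirDeriv_pow, dirDeriv_const, dirDeriv_baseT, dirDeriv_baseX, dirDeriv_baseU, h, hi]
  push_cast
  ring

/-- A jet of two functions over the point `b`, with prescribed first derivatives `y` and `z`. -/
def sysJet (b : Base (Fin 2)) (y₁₀ y₀₁ z₁₀ z₀₁ : ℝ) : Jet (Fin 2) :=
  (b.1, b.2.1, fun i j k => match j, k with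
    | 0, 0 => b.2.2 i
    | 1, 0 => ![y₁₀, z₁₀] i
    | 0, 1 => ![y₀₁, z₀₁] i
    | _, _ => 0)

/-- Every symmetry operator of the potential system is in the algebra `𝔱₁`: the invariance
conditions are split with respect to `u_t` and `u_x`, and then with respect to `u`. -/
theorem exists_sysField_of_isLieSymmetryOperator (hD : IsOpen D) (hDc : IsConnected D)
    (hDx : ∀ z ∈ D, z.2 ≠ 0) (hI : IsOpen I) (hIc : IsConnected I) (hJ : IsOpen J)
    (hJc : IsConnected J) {Q : Base (Fin 2) → Base (Fin 2)}
    (hQ : IsLieSymmetryOperator (sysDomain D I J) (potentialSystem densityX fluxX) Q) :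
    ∃ c f, IsSolutionOn D potentialEq f ∧ Set.EqOn Q (sysField c f) (sysDomain D I J) := by
  obtain ⟨hQs, hinv⟩ := hQ
  have hΩ := isOpen_sysDomain hD hI hJ
  set Ω := sysDomain D I J with hΩdef
  obtain ⟨τ, hτdef⟩ : ∃ τ : Base (Fin 2) → ℝ, τ = fun b => (Q b).1 := ⟨_, rfl⟩
  obtain ⟨ξ, hξdef⟩ : ∃ ξ : Base (Fin 2) → ℝ, ξ = fun b => (Q b).2.1 := ⟨_, rfl⟩
  obtain ⟨φ, hφdef⟩ : ∃ φ : Base (Fin 2) → ℝ, φ = fun b => (Q b).2.2 0 := ⟨_, rfl⟩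
  obtain ⟨η, hηdef⟩ : ∃ η : Base (Fin 2) → ℝ, η = fun b => (Q b).2.2 1 := ⟨_, rfl⟩
  have hQeq : ∀ b, Q b = (τ b, ξ b, ![φ b, η b]) := fun b => by
    ext i
    · simp [hτdef]
    · simp [hξdef]
    · fin_cases i <;> simp [hφdef, hηdef]
  have hτ : ContDiffOn ℝ ∞ τ Ω := by rw [hτdef]; fun_prop
  have hξ : ContDiffOn ℝ ∞ ξ Ω := by rw [hξdef]; fun_prop
  have hφ : ContDiffOn ℝ ∞ φ Ω := by rw [hφdef]; fun_prop
  have hη : ContDiffOn ℝ ∞ η Ω := by rw [hηdef]; fun_prop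
  have hx : ∀ b ∈ Ω, b.2.1 ≠ 0 := fun b hb => hDx (b.1, b.2.1) hb.1
  -- the invariance conditions at the jets with `v_x = x u`, `v_t = x u_x - u`
  have hE : ∀ b ∈ Ω, ∀ y₁₀ y₀₁ : ℝ, _ = (0 : ℝ) ∧ _ = (0 : ℝ) := fun b hb y₁₀ y₀₁ => by
    have h := lineDeriv_potentialSystem_prolongation hQeq (hτ.smoothAt hΩ hb)
      (hξ.smoothAt hΩ hb) (hφ.smoothAt hΩ hb) (hη.smoothAt hΩ hb)
      (p := sysJet b y₁₀ y₀₁ (b.2.1 * y₀₁ - b.2.2 0) (b.2.1 * b.2.2 0)) (y₁₀ := y₁₀)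
      (y₀₁ := y₀₁) (z₁₀ := b.2.1 * y₀₁ - b.2.2 0) (z₀₁ := b.2.1 * b.2.2 0) rfl rfl rfl rfl rfl
    have h' := hinv (sysJet b y₁₀ y₀₁ (b.2.1 * y₀₁ - b.2.2 0) (b.2.1 * b.2.2 0)) hb
      ((potentialSystem_densityX_fluxX _).2 ⟨rfl, rfl⟩)
    exact ⟨h.1.symm.trans (h' 0), h.2.symm.trans (h' 1)⟩
  have zero_of : ∀ {F : Base (Fin 2) → ℝ}, (∀ b ∈ Ω, F b = 0) → ∀ w, ∀ b ∈ Ω,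
      dirDeriv w F b = 0 := fun {F} h w b hb => by
    rw [dirDeriv_congr hΩ (G := fun _ => 0) h hb, dirDeriv_const]
  have zero_comm : ∀ {F : Base (Fin 2) → ℝ} {w : Base (Fin 2)}, ContDiffOn ℝ ∞ F Ω →
      (∀ b ∈ Ω, dirDeriv w F b = 0) → ∀ w', ∀ b ∈ Ω, dirDeriv w (dirDeriv w' F) b = 0 :=
    fun {F w} hF h w' b hb => by
      rw [dirDeriv_comm (hF.smoothAt hΩ hb), zero_of h w' b hb]
  -- `u_x²` in the first condition
  have τu : ∀ b ∈ Ω, dirDeriv (eU 0) τ b = 0 := fun b hb => by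
    refine mul_left_cancel₀ (hx b hb) ?_
    linear_combination -((hE b hb 0 1).1 + (hE b hb 0 (-1)).1 - 2 * (hE b hb 0 0).1) / 2
  -- `u_x` in the first condition and `u_t` in the second one
  have a1 : ∀ b ∈ Ω, dirDeriv eX τ b + b.2.1 * b.2.2 0 * dirDeriv (eU 1) τ b = 0 :=
    fun b hb => by
    refine mul_left_cancel₀ (hx b hb) ?_
    have h1 := (hE b hb 0 1).1
    have h2 := (hE b hb 0 (-1)).1
    have h3 := (hE b hb 1 0).2
    have h4 := (hE b hb 0 0).2
    rw [τu b hb] at h1 h2 h3 h4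
    linear_combination (h3 - h4) / 2 - (h1 - h2) / 4
  have τv : ∀ b ∈ Ω, dirDeriv (eU 1) τ b = 0 := fun b hb => by
    have h := zero_of a1 (eU 0) b hb
    have hs := hτ.smoothAt hΩ hb
    simp (disch := fun_prop) only [dirDeriv_add, dirDeriv_mul, dirDeriv_baseX, dirDeriv_baseU,
      zero_comm hτ τu _ b hb] at h
    simp only [Pi.single_eq_same] at h
    refine mul_left_cancel₀ (hx b hb) ?_
    linear_combination h
  have τx : ∀ b ∈ Ω, dirDeriv eX τ b = 0 := fun b hb => by
    simpa [τv b hb] using a1 b hb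
  -- `u_x²` and `u_x` in the second condition
  have ξu : ∀ b ∈ Ω, dirDeriv (eU 0) ξ b = 0 := fun b hb => by
    refine mul_left_cancel₀ (hx b hb) ?_
    have h1 := (hE b hb 0 1).2
    have h2 := (hE b hb 0 (-1)).2
    have h0 := (hE b hb 0 0).2
    rw [τu b hb, τv b hb, τx b hb] at h1 h2 h0
    linear_combination (h1 + h2 - 2 * h0) / 2
  have ηu : ∀ b ∈ Ω, dirDeriv (eU 0) η b = 0 := fun b hb => by
    have h1 := (hE b hb 0 1).1
    have h2 := (hE b hb 0 (-1)).1
    rw [τu b hb, τv b hb, τx b hb, ξu b hb] at h1 h2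
    linear_combination (h1 - h2) / 2
  have a2 : ∀ b ∈ Ω, b.2.1 * dirDeriv (eU 1) η b - b.2.1 * dirDeriv eT τ b - ξ b
      - b.2.1 * dirDeriv (eU 0) φ b + b.2.1 * dirDeriv eX ξ b = 0 := fun b hb => by
    have h1 := (hE b hb 0 1).2
    have h2 := (hE b hb 0 (-1)).2
    rw [τu b hb, τv b hb, τx b hb, ξu b hb] at h1 h2
    linear_combination (h1 - h2) / 2
  -- the remaining terms of both conditions
  have a3 : ∀ b ∈ Ω, dirDeriv eX η b + b.2.1 * b.2.2 0 * dirDeriv (eU 1) η b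
      - (dirDeriv eX ξ b + b.2.1 * b.2.2 0 * dirDeriv (eU 1) ξ b) * (b.2.1 * b.2.2 0)
      - ξ b * b.2.2 0 - b.2.1 * φ b = 0 := fun b hb => by
    have h0 := (hE b hb 0 0).1
    rw [τu b hb, τv b hb, τx b hb] at h0
    linear_combination h0
  have a4 : ∀ b ∈ Ω, 2 * dirDeriv eX ξ b + 2 * (b.2.1 * b.2.2 0) * dirDeriv (eU 1) ξ b
      - dirDeriv eT τ b = 0 := fun b hb => by
    have h := zero_of a3 (eU 0) b hb
    have hs := hξ.smoothAt hΩ hb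
    have hs' := hη.smoothAt hΩ hb
    have hs'' := hφ.smoothAt hΩ hb
    simp (disch := fun_prop) only [dirDeriv_add, dirDeriv_sub, dirDeriv_mul, dirDeriv_baseX,
      dirDeriv_baseU, zero_comm hξ ξu _ b hb, zero_comm hη ηu _ b hb, ξu b hb] at h
    simp only [Pi.single_eq_same] at h
    refine mul_left_cancel₀ (hx b hb) ?_
    linear_combination a2 b hb - h
  have ξv : ∀ b ∈ Ω, dirDeriv (eU 1) ξ b = 0 := fun b hb => by
    have h := zero_of a4 (eU 0) b hb
    have hs := hξ.smoothAt hΩ hb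
    have hs' := hτ.smoothAt hΩ hb
    simp (disch := fun_prop) only [dirDeriv_add, dirDeriv_sub, dirDeriv_mul, dirDeriv_baseX,
      dirDeriv_baseU, zero_comm hξ ξu _ b hb, zero_comm hτ τu _ b hb, dirDeriv_const] at h
    simp only [Pi.single_eq_same] at h
    refine mul_left_cancel₀ (hx b hb) ?_
    linear_combination h / 2
  have ξx : ∀ b ∈ Ω, 2 * dirDeriv eX ξ b = dirDeriv eT τ b := fun b hb => by
    have h := a4 b hb
    rw [ξv b hb] at h
    linear_combination h
  have ξxx : ∀ b ∈ Ω, dirDeriv eX (dirDeriv eX ξ) b = 0 := fun b hb => by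
    have := hξ.smoothAt hΩ hb
    have h1 := dirDeriv_congr (w := eX) hΩ ξx hb
    rw [zero_comm hτ τx eT b hb] at h1
    simp (disch := fun_prop) only [dirDeriv_mul, dirDeriv_const] at h1
    linear_combination h1 / 2
  -- the coefficient of `∂_u` is determined by the others
  have a5 : ∀ b ∈ Ω, b.2.1 * φ b = dirDeriv eX η b
      + b.2.2 0 * (b.2.1 * dirDeriv (eU 1) η b - b.2.1 * dirDeriv eX ξ b - ξ b) :=
    fun b hb => by
    have h := a3 b hb
    rw [ξv b hb] at h
    linear_combination -h
  have a5v : ∀ b ∈ Ω, b.2.1 * dirDeriv (eU 1) φ b = dirDeriv eX (dirDeriv (eU 1) η) b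
      + b.2.2 0 * b.2.1 * dirDeriv (eU 1) (dirDeriv (eU 1) η) b := fun b hb => by
    have h := dirDeriv_congr (w := eU 1) hΩ a5 hb
    have hs := hξ.smoothAt hΩ hb
    have hs' := hη.smoothAt hΩ hb
    have hs'' := hφ.smoothAt hΩ hb
    rw [dirDeriv_comm (w' := eU 1) hs']
    simp (disch := fun_prop) only [dirDeriv_add, dirDeriv_sub, dirDeriv_mul, dirDeriv_baseX,
      dirDeriv_baseU, zero_comm hξ ξv _ b hb, ξv b hb] at h
    simpa [mul_assoc] using h
  have a5x : ∀ b ∈ Ω, b.2.1 * dirDeriv eX φ b + φ b = dirDeriv eX (dirDeriv eX η) b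
      + b.2.2 0 * (dirDeriv (eU 1) η b + b.2.1 * dirDeriv eX (dirDeriv (eU 1) η) b
        - 2 * dirDeriv eX ξ b) := fun b hb => by
    have h := dirDeriv_congr (w := eX) hΩ a5 hb
    have hs := hξ.smoothAt hΩ hb
    have hs' := hη.smoothAt hΩ hb
    have hs'' := hφ.smoothAt hΩ hb
    simp (disch := fun_prop) only [dirDeriv_add, dirDeriv_sub, dirDeriv_mul, dirDeriv_baseX,
      dirDeriv_baseU, ξxx b hb] at h
    simp only [Pi.zero_apply] at h
    linear_combination h
  -- the second condition after the elimination of `φ`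
  have a6 : ∀ b ∈ Ω, b.2.1 * dirDeriv eT η b + 2 * dirDeriv eX η b
      - b.2.1 * dirDeriv eX (dirDeriv eX η) b
      + b.2.2 0 * (b.2.1 * dirDeriv eT τ b - b.2.1 ^ 2 * dirDeriv eT ξ b - 2 * ξ b
        - 2 * b.2.1 ^ 2 * dirDeriv eX (dirDeriv (eU 1) η) b)
      - b.2.2 0 ^ 2 * (b.2.1 ^ 3 * dirDeriv (eU 1) (dirDeriv (eU 1) η) b) = 0 := fun b hb => by
    have h := (hE b hb 0 0).2
    rw [τu b hb, τv b hb, τx b hb, ξu b hb, ξv b hb] at h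
    linear_combination b.2.1 * h + b.2.1 * a5x b hb + b.2.1 ^ 2 * b.2.2 0 * a5v b hb
      - 2 * a5 b hb
  -- a quadratic polynomial in `u` whose coefficients do not depend on `u`: its derivatives in `u`
  -- separate the coefficients
  have ηvv_e2 : ∀ b ∈ Ω, (b.2.1 * dirDeriv eT τ b - b.2.1 ^ 2 * dirDeriv eT ξ b - 2 * ξ b
        - 2 * b.2.1 ^ 2 * dirDeriv eX (dirDeriv (eU 1) η) b)
      - 2 * b.2.2 0 * (b.2.1 ^ 3 * dirDeriv (eU 1) (dirDeriv (eU 1) η) b) = 0 :=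
    fun b hb => by
    have h := zero_of a6 (eU 0) b hb
    have hs := hξ.smoothAt hΩ hb
    have hs' := hη.smoothAt hΩ hb
    have hs'' := hτ.smoothAt hΩ hb
    have z1 : ∀ w w', dirDeriv (eU 0) (dirDeriv w (dirDeriv w' η)) b = 0 := fun w w' =>
      zero_comm (hη.dirDeriv hΩ) (zero_comm hη ηu w') w b hb
    simp (disch := fun_prop) only [dirDeriv_add, dirDeriv_sub, dirDeriv_mul, dirDeriv_pow,
      dirDeriv_baseX, dirDeriv_baseU, dirDeriv_const, z1, zero_comm hξ ξu _ b hb,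
      zero_comm hη ηu _ b hb, zero_comm hτ τu _ b hb, ξu b hb] at h
    simp only [Pi.single_eq_same] at h
    push_cast at h
    linear_combination h
  have ηvv : ∀ b ∈ Ω, dirDeriv (eU 1) (dirDeriv (eU 1) η) b = 0 := fun b hb => by
    have h := zero_of ηvv_e2 (eU 0) b hb
    have hs := hξ.smoothAt hΩ hb
    have hs' := hη.smoothAt hΩ hb
    have hs'' := hτ.smoothAt hΩ hb
    have z1 : ∀ w w', dirDeriv (eU 0) (dirDeriv w (dirDeriv w' η)) b = 0 := fun w w' =>
      zero_comm (hη.dirDeriv hΩ) (zero_comm hη ηu w') w b hb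
    simp (disch := fun_prop) only [dirDeriv_sub, dirDeriv_mul, dirDeriv_pow,
      dirDeriv_baseX, dirDeriv_baseU, dirDeriv_const, z1, zero_comm hξ ξu _ b hb,
      zero_comm hτ τu _ b hb, ξu b hb] at h
    simp only [Pi.single_eq_same] at h
    refine mul_left_cancel₀ (pow_ne_zero 3 (hx b hb)) ?_
    linear_combination -h / 2
  have e2 : ∀ b ∈ Ω, b.2.1 ^ 2 * (2 * dirDeriv eX (dirDeriv (eU 1) η) b + dirDeriv eT ξ b)
      + 2 * ξ b - b.2.1 * dirDeriv eT τ b = 0 := fun b hb => by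
    have h := ηvv_e2 b hb
    rw [ηvv b hb] at h
    linear_combination -h
  have e1 : ∀ b ∈ Ω, b.2.1 * dirDeriv eT η b + 2 * dirDeriv eX η b
      - b.2.1 * dirDeriv eX (dirDeriv eX η) b = 0 := fun b hb => by
    have h := a6 b hb
    rw [ηvv b hb] at h
    linear_combination h + b.2.2 0 * e2 b hb
  have e3 : ∀ b ∈ Ω, b.2.1 * dirDeriv eT (dirDeriv (eU 1) η) b
      + 2 * dirDeriv eX (dirDeriv (eU 1) η) b
      - b.2.1 * dirDeriv eX (dirDeriv eX (dirDeriv (eU 1) η)) b = 0 := fun b hb => by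
    have h := zero_of e1 (eU 1) b hb
    have hs := hη.smoothAt hΩ hb
    simp (disch := fun_prop) only [dirDeriv_add, dirDeriv_sub, dirDeriv_mul, dirDeriv_const,
      dirDeriv_baseX] at h
    rw [dirDeriv_comm (w' := eT) hs, dirDeriv_comm (w' := eX) hs,
      dirDeriv_comm (w' := eX) hs.dirDeriv,
      dirDeriv_congr (w := eX) hΩ (fun q hq => dirDeriv_comm (hη.smoothAt hΩ hq)) hb] at h
    linear_combination h
  -- restriction to a plane `u = const`, `v = const`
  obtain ⟨u₀, hu₀⟩ := hIc.nonempty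
  obtain ⟨v₀, hv₀⟩ := hJc.nonempty
  have hmem : ∀ z ∈ D, ((z.1, z.2, ![u₀, v₀]) : Base (Fin 2)) ∈ Ω := fun z hz => ⟨hz, hu₀, hv₀⟩
  have hres : ∀ {F : Base (Fin 2) → ℝ}, ContDiffOn ℝ ∞ F Ω →
      ContDiffOn ℝ ∞ (fun z : ℝ × ℝ => F (z.1, z.2, ![u₀, v₀])) D := fun hF =>
    hF.comp (by fun_prop) hmem
  have hηv : ContDiffOn ℝ ∞ (dirDeriv (eU 1) η) Ω := hη.dirDeriv hΩ
  have hG : ContDiffOn ℝ ∞ (fun b => η b - dirDeriv (eU 1) η b * b.2.2 1) Ω :=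
    hη.sub (hηv.mul (by fun_prop))
  obtain ⟨c, hc⟩ := exists_coeff_of_determining hD hDc hDx (hres hτ) (hres hξ) (hres hηv)
    (fun z hz => by
      rw [partialX_eq_dirDeriv, dirDeriv_restrict]; exact τx _ (hmem z hz))
    (fun z hz => by
      rw [partialX_eq_dirDeriv, partialT_eq_dirDeriv, dirDeriv_restrict, dirDeriv_restrict]
      exact ξx _ (hmem z hz))
    (fun z hz => by
      rw [partialX_eq_dirDeriv, partialT_eq_dirDeriv, dirDeriv_restrict, dirDeriv_restrict,
        dirDeriv_restrict]
      exact e2 _ (hmem z hz))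
    (fun z hz => by
      rw [partialX_eq_dirDeriv, partialT_eq_dirDeriv, dirDeriv_restrict, dirDeriv_restrict,
        dirDeriv_restrict]
      have := e3 _ (hmem z hz)
      linear_combination this)
  -- `η = A v + B` with `A = η_v`, so that `B` is recovered at `v = v₀` as `η - v₀ A`
  have hsolA : IsSolutionOn D potentialEq fun z => dirDeriv (eU 1) η (z.1, z.2, ![u₀, v₀]) := by
    rw [isSolutionOn_potentialEq_iff hDx, partialX_eq_dirDeriv, partialT_eq_dirDeriv]
    refine ⟨hres hηv, fun z hz => ?_⟩
    rw [dirDeriv_restrict, dirDeriv_restrict, dirDeriv_restrict]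
    exact e3 _ (hmem z hz)
  have hsolη : IsSolutionOn D potentialEq fun z => η (z.1, z.2, ![u₀, v₀]) := by
    rw [isSolutionOn_potentialEq_iff hDx, partialX_eq_dirDeriv, partialT_eq_dirDeriv]
    refine ⟨hres hη, fun z hz => ?_⟩
    rw [dirDeriv_restrict, dirDeriv_restrict, dirDeriv_restrict]
    exact e1 _ (hmem z hz)
  obtain ⟨f, hf⟩ : ∃ f, f = fun z : ℝ × ℝ => η (z.1, z.2, ![u₀, v₀])
      + -v₀ * dirDeriv (eU 1) η (z.1, z.2, ![u₀, v₀]) := ⟨_, rfl⟩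
  have hfsol : IsSolutionOn D potentialEq f := by
    rw [hf]; exact hsolη.add hD hDx (hsolA.const_mul hD hDx (-v₀))
  have hseg : ∀ {t x : ℝ} {y : Fin 2 → ℝ}, ((t, x, y) : Base (Fin 2)) ∈ Ω →
      ∀ r ∈ segment ℝ y ![u₀, v₀], ((t, x, r) : Base (Fin 2)) ∈ Ω := by
    intro t x y hb r hr
    have hproj : ∀ i, r i ∈ segment ℝ (y i) (![u₀, v₀] i) := by
      intro i
      rw [segment_eq_image'] at hr ⊢
      obtain ⟨s, hs, rfl⟩ := hr
      exact ⟨s, hs, rfl⟩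
    exact ⟨hb.1, hIc.isPreconnected.convex.segment_subset hb.2.1 hu₀ (hproj 0),
      hJc.isPreconnected.convex.segment_subset hb.2.2 hv₀ (hproj 1)⟩
  have fin2 : ∀ {F : Base (Fin 2) → ℝ}, (∀ b ∈ Ω, dirDeriv (eU 0) F b = 0) →
      (∀ b ∈ Ω, dirDeriv (eU 1) F b = 0) → ∀ i, ∀ b ∈ Ω, dirDeriv (eU i) F b = 0 :=
    fun h0 h1 i => by fin_cases i <;> assumption
  have vτ : ∀ b ∈ Ω, τ b = coeffT c b.1 := by
    rintro ⟨t, x, y⟩ hb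
    rw [eq_of_dirDeriv_eU_eq_zero hΩ hτ (fin2 τu τv) (hseg hb)]
    exact (hc (t, x) hb.1).1
  have vξ : ∀ b ∈ Ω, ξ b = coeffX c b.1 b.2.1 := by
    rintro ⟨t, x, y⟩ hb
    rw [eq_of_dirDeriv_eU_eq_zero hΩ hξ (fin2 ξu ξv) (hseg hb)]
    exact (hc (t, x) hb.1).2.1
  have vη : ∀ b ∈ Ω, η b = coeffV c b.1 b.2.1 * b.2.2 1 + f (b.1, b.2.1) := by
    rintro ⟨t, x, y⟩ hb
    have r1 := eq_of_dirDeriv_eU_eq_zero hΩ hηv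
      (fin2 (zero_comm hη ηu (eU 1)) ηvv) (hseg hb)
    have r2 := eq_of_dirDeriv_eU_eq_zero hΩ hG (fin2
      (fun b hb => by
        have hs := hη.smoothAt hΩ hb
        simp (disch := fun_prop) only [dirDeriv_sub, dirDeriv_mul, dirDeriv_baseU]
        rw [zero_comm hη ηu (eU 1) b hb, ηu b hb]
        simp)
      (fun b hb => by
        have hs := hη.smoothAt hΩ hb
        simp (disch := fun_prop) only [dirDeriv_sub, dirDeriv_mul, dirDeriv_baseU]
        rw [ηvv b hb]
        simp)) (hseg hb)
    have h3 := (hc (t, x) hb.1).2.2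
    simp only [hf, coeffV, Matrix.cons_val] at *
    linear_combination r2 + y 1 * r1 + y 1 * h3
  refine ⟨c, f, hfsol, fun b hb => ?_⟩
  have hx0 := hx b hb
  have vφ : φ b = coeffU c b.1 b.2.1 (b.2.2 0) (b.2.2 1) + b.2.1⁻¹ * partialX f (b.1, b.2.1) := by
    have h := a5 b hb
    rw [dirDeriv_congr (w := eX) hΩ vη hb, dirDeriv_congr (w := eU 1) hΩ vη hb,
      dirDeriv_congr (w := eX) hΩ vξ hb, dirDeriv_coeffV (hfsol.1.smoothAt hD hb.1),
      dirDeriv_coeffV (hfsol.1.smoothAt hD hb.1), dirDeriv_coeffX, vξ b hb] at h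
    refine mul_left_cancel₀ hx0 ?_
    rw [h]
    simp only [coeffU, coeffV, coeffX, Pi.single_eq_same, Pi.zero_apply]
    field_simp
    ring
  rw [hQeq, vτ b hb, vξ b hb, vφ, vη b hb]
  rfl

/-- The elements of the algebra `𝔱₁` satisfy the invariance conditions. -/
theorem isLieSymmetryOperator_of_eqOn_sysField (hD : IsOpen D)
    (hDx : ∀ z ∈ D, z.2 ≠ 0) (hI : IsOpen I) (hJ : IsOpen J) {c : Fin 4 → ℝ} {f : ℝ × ℝ → ℝ}
    (hf : IsSolutionOn D potentialEq f) {Q : Base (Fin 2) → Base (Fin 2)}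
    (hQ : Set.EqOn Q (sysField c f) (sysDomain D I J)) :
    IsLieSymmetryOperator (sysDomain D I J) (potentialSystem densityX fluxX) Q := by
  rw [isSolutionOn_potentialEq_iff hDx] at hf
  obtain ⟨hf, hL⟩ := hf
  have hQs : ContDiffOn ℝ ∞ Q (sysDomain D I J) := (contDiffOn_sysField hD hDx hf).congr hQ
  refine ⟨hQs, fun p hp hsat => ?_⟩
  obtain ⟨hsat1, hsat2⟩ := (potentialSystem_densityX_fluxX p).1 hsat
  have hΩ := isOpen_sysDomain hD hI hJ
  set Ω := sysDomain D I J with hΩdef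
  obtain ⟨τ, hτdef⟩ : ∃ τ : Base (Fin 2) → ℝ, τ = fun b => (Q b).1 := ⟨_, rfl⟩
  obtain ⟨ξ, hξdef⟩ : ∃ ξ : Base (Fin 2) → ℝ, ξ = fun b => (Q b).2.1 := ⟨_, rfl⟩
  obtain ⟨φ, hφdef⟩ : ∃ φ : Base (Fin 2) → ℝ, φ = fun b => (Q b).2.2 0 := ⟨_, rfl⟩
  obtain ⟨η, hηdef⟩ : ∃ η : Base (Fin 2) → ℝ, η = fun b => (Q b).2.2 1 := ⟨_, rfl⟩
  have hQeq : ∀ b, Q b = (τ b, ξ b, ![φ b, η b]) := fun b => by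
    ext i
    · simp [hτdef]
    · simp [hξdef]
    · fin_cases i <;> simp [hφdef, hηdef]
  have hτ : ContDiffOn ℝ ∞ τ Ω := by rw [hτdef]; fun_prop
  have hξ : ContDiffOn ℝ ∞ ξ Ω := by rw [hξdef]; fun_prop
  have hφ : ContDiffOn ℝ ∞ φ Ω := by rw [hφdef]; fun_prop
  have hη : ContDiffOn ℝ ∞ η Ω := by rw [hηdef]; fun_prop
  have vτ : ∀ b ∈ Ω, τ b = coeffT c b.1 := fun b hb => by
    rw [hτdef]; simp only [hQ hb]; rfl
  have vξ : ∀ b ∈ Ω, ξ b = coeffX c b.1 b.2.1 := fun b hb => by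
    rw [hξdef]; simp only [hQ hb]; rfl
  have vφ : ∀ b ∈ Ω, φ b = coeffU c b.1 b.2.1 (b.2.2 0) (b.2.2 1)
      + b.2.1⁻¹ * partialX f (b.1, b.2.1) := fun b hb => by
    rw [hφdef]; simp only [hQ hb]; rfl
  have vη : ∀ b ∈ Ω, η b = coeffV c b.1 b.2.1 * b.2.2 1 + f (b.1, b.2.1) := fun b hb => by
    rw [hηdef]; simp only [hQ hb]; rfl
  have dτ : ∀ w : Base (Fin 2), dirDeriv w τ (jetBase p) = _ := fun w =>
    (dirDeriv_congr hΩ vτ hp).trans dirDeriv_coeffT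
  have dξ : ∀ w : Base (Fin 2), dirDeriv w ξ (jetBase p) = _ := fun w =>
    (dirDeriv_congr hΩ vξ hp).trans dirDeriv_coeffX
  have dφ : ∀ w : Base (Fin 2), dirDeriv w φ (jetBase p) = _ := fun w =>
    (dirDeriv_congr hΩ vφ hp).trans (dirDeriv_coeffU hD hDx hf hp.1)
  have dη : ∀ w : Base (Fin 2), dirDeriv w η (jetBase p) = _ := fun w =>
    (dirDeriv_congr hΩ vη hp).trans (dirDeriv_coeffV (hf.smoothAt hD hp.1) 1)
  have hx : (jetBase p).2.1 ≠ 0 := hDx _ hp.1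
  have hz := hL _ hp.1
  obtain ⟨h1, h2⟩ := lineDeriv_potentialSystem_prolongation hQeq (hτ.smoothAt hΩ hp)
    (hξ.smoothAt hΩ hp) (hφ.smoothAt hΩ hp) (hη.smoothAt hΩ hp) (p := p) rfl
    (y₁₀ := p.2.2 0 1 0) (y₀₁ := p.2.2 0 0 1) rfl rfl hsat2 hsat1
  have e : p.2.1 = (jetBase p).2.1 := rfl
  have e' : p.2.2 0 0 0 = (jetBase p).2.2 0 := rfl
  refine Fin.forall_fin_two.2 ⟨h1.trans ?_, h2.trans ?_⟩
  · simp only [dτ, dξ, dη, vξ _ hp, vφ _ hp, e, e']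
    simp [coeffX, coeffU, coeffV]
    field_simp
    ring
  · simp only [dτ, dξ, dφ, dη, vξ _ hp, vφ _ hp, e, e']
    simp [coeffX, coeffU, coeffV]
    field_simp
    linear_combination hz

/-- The algebra `𝔱₁` is closed under the Lie bracket. -/
theorem lieBracket_sysField (hD : IsOpen D) (hDx : ∀ z ∈ D, z.2 ≠ 0) (hI : IsOpen I)
    (hJ : IsOpen J) {c d : Fin 4 → ℝ} {f g : ℝ × ℝ → ℝ} (hf : ContDiffOn ℝ ∞ f D)
    (hg : ContDiffOn ℝ ∞ g D) :
    Set.EqOn (VectorField.lieBracket ℝ (sysField c f) (sysField d g))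
      (sysField ![2 * (c 0 * d 1 - c 1 * d 0), 4 * (c 0 * d 2 - c 2 * d 0),
          2 * (c 1 * d 2 - c 2 * d 1), 2 * (c 0 * d 2 - c 2 * d 0)]
        (fun z => symmetryAction c g z + -1 * symmetryAction d f z)) (sysDomain D I J) := by
  intro b hb
  have hΩ := isOpen_sysDomain hD hI hJ
  obtain ⟨h1, h2, h3⟩ := lieBracket_coeff
    ((contDiffOn_sysField (c := c) hD hDx hf).contDiffAt (hΩ.mem_nhds hb))
    ((contDiffOn_sysField (c := d) hD hDx hg).contDiffAt (hΩ.mem_nhds hb))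
  have h4 := h3 1
  have h3 := h3 0
  have hs : partialX (fun z => symmetryAction c g z + -1 * symmetryAction d f z) (b.1, b.2.1) =
      partialX (symmetryAction c g) (b.1, b.2.1) - partialX (symmetryAction d f) (b.1, b.2.1) := by
    have s1 := (hg.symmetryAction hD c).smoothAt hD hb.1
    have s2 := (hf.symmetryAction hD d).smoothAt hD hb.1
    simp only [partialX_eq_dirDeriv]
    simp (disch := fun_prop) only [dirDeriv_add, dirDeriv_mul, dirDeriv_const]
    ring
  rw [partialX_symmetryAction hD hf d hb.1, partialX_symmetryAction hD hg c hb.1] at hs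
  simp only [sysField, Matrix.cons_val_zero, Matrix.cons_val_one, dirDeriv_coeffT,
    dirDeriv_coeffX, dirDeriv_coeffU hD hDx hf hb.1, dirDeriv_coeffU hD hDx hg hb.1,
    dirDeriv_coeffV (hf.smoothAt hD hb.1), dirDeriv_coeffV (hg.smoothAt hD hb.1)] at h1 h2 h3 h4
  have hx : b.2.1 ≠ 0 := hDx _ hb.1
  refine Prod.ext ?_ (Prod.ext ?_ (funext (Fin.forall_fin_two.2 ⟨?_, ?_⟩)))
  · refine h1.trans ?_
    simp only [sysField, coeffT, Matrix.cons_val]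
    ring
  · refine h2.trans ?_
    simp only [sysField, coeffT, coeffX, Matrix.cons_val]
    ring
  · refine h3.trans ?_
    simp only [sysField, hs, coeffT, coeffX, coeffU, coeffV, Matrix.cons_val]
    field_simp
    ring
  · refine h4.trans ?_
    simp only [sysField, coeffT, coeffX, coeffV, Matrix.cons_val, symmetryAction]
    ring

/-- The operator `x⁻¹ f_x ∂_u + f ∂_v` depends on `f` linearly only over `D`, where `f` is
differentiable, hence the elements of `𝔱₁` are put into normal form only on the domain. -/
theorem isMaximalLieInvarianceAlgebra_algT1 (hD : IsOpen D) (hDc : IsConnected D)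
    (hDx : ∀ z ∈ D, z.2 ≠ 0) (hI : IsOpen I) (hIc : IsConnected I) (hJ : IsOpen J)
    (hJc : IsConnected J) :
    IsMaximalLieInvarianceAlgebra (sysDomain D I J) (potentialSystem densityX fluxX)
      (algT1 D) := by
  refine ⟨fun Q hQ R hR => ?_, fun Q => ⟨fun hQ => ?_, ?_⟩⟩
  · obtain ⟨c, f, hf, hQ⟩ := exists_eqOn_sysField_of_mem_algT1 (I := I) (J := J) hD hDx hQ
    obtain ⟨d, g, hg, hR⟩ := exists_eqOn_sysField_of_mem_algT1 (I := I) (J := J) hD hDx hR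
    have h : Set.EqOn (VectorField.lieBracket ℝ Q R)
        (VectorField.lieBracket ℝ (sysField c f) (sysField d g)) (sysDomain D I J) := by
      intro b hb
      have hmem := (isOpen_sysDomain hD hI hJ).mem_nhds hb
      exact Filter.EventuallyEq.lieBracket_vectorField_eq (Filter.eventually_of_mem hmem hQ)
        (Filter.eventually_of_mem hmem hR)
    exact ⟨_, sysField_mem_algT1 ((hg.symmetryAction hD hDx c).add hD hDx
      ((hf.symmetryAction hD hDx d).const_mul hD hDx (-1))),
      h.trans (lieBracket_sysField hD hDx hI hJ hf.1 hg.1)⟩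
  · obtain ⟨c, f, hf, h⟩ :=
      exists_sysField_of_isLieSymmetryOperator hD hDc hDx hI hIc hJ hJc hQ
    exact ⟨_, sysField_mem_algT1 hf, h⟩
  · rintro ⟨R, hR, h⟩
    obtain ⟨c, f, hf, hR⟩ := exists_eqOn_sysField_of_mem_algT1 (I := I) (J := J) hD hDx hR
    exact isLieSymmetryOperator_of_eqOn_sysField hD hDx hI hJ hf (h.trans hR)

/-- Only the term `-2 c₂ v` of the coefficient of `∂_u` depends on the potential. -/
theorem isPurePotentialSymmetryOperator_sysField_iff (hD : IsOpen D) (hDc : IsConnected D)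
    (hDx : ∀ z ∈ D, z.2 ≠ 0) (hI : IsOpen I) (hIc : IsConnected I) (hJ : IsOpen J)
    (hJc : IsConnected J) {c : Fin 4 → ℝ} {f : ℝ × ℝ → ℝ} (hf : IsSolutionOn D potentialEq f) :
    IsPurePotentialSymmetryOperator (sysDomain D I J) heatEq densityX fluxX charX
      (sysField c f) ↔ c 2 ≠ 0 := by
  constructor
  · rintro ⟨-, -, t, x, u, v, v', -, -, h⟩ hc
    exact h (by simp [sysField, coeffU, hc])
  · intro hc
    obtain ⟨⟨t, x⟩, hz⟩ := hDc.nonempty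
    obtain ⟨u, hu⟩ := hIc.nonempty
    obtain ⟨v, hv⟩ := hJc.nonempty
    -- an open set of reals has a second element near each of its elements
    obtain ⟨v', hv', hne⟩ : ∃ v' ∈ J, v' ≠ v := by
      obtain ⟨ε, hε, hball⟩ := Metric.isOpen_iff.1 hJ v hv
      exact ⟨v + ε / 2, hball (by simp [abs_of_pos hε]; linarith), by linarith⟩
    refine ⟨hasCharacteristic_heatEq,
      isLieSymmetryOperator_of_eqOn_sysField hD hDx hI hJ hf fun _ _ => rfl,
      t, x, u, v, v', ⟨hz, hu, hv⟩, ⟨hz, hu, hv'⟩, fun h => hne ?_⟩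
    have h' := h.2.2
    simp only [sysField, coeffU, Matrix.cons_val] at h'
    refine mul_left_cancel₀ hc ?_
    linear_combination h' / 2

end System

theorem mainTheorem2 (D : Set (ℝ × ℝ)) (hDo : IsOpen D) (hDc : IsConnected D)
    (hDx : ∀ z ∈ D, z.2 ≠ 0)
    (I J : Set ℝ) (hIo : IsOpen I) (hIc : IsConnected I) (hJo : IsOpen J) (hJc : IsConnected J) :
    IsMaximalLieInvarianceAlgebra (eqDomain D J) (fun _ : Unit => potentialEq) (algT0 D) ∧
    IsMaximalLieInvarianceAlgebra (sysDomain D I J) (potentialSystem densityX fluxX) (algT1 D) ∧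
    ∀ (c : Fin 4 → ℝ) (f : ℝ × ℝ → ℝ), IsSolutionOn D potentialEq f →
      (IsPurePotentialSymmetryOperator (sysDomain D I J) heatEq densityX fluxX charX
          (∑ i, c i • sysOp i + sysOpOf f) ↔ c 2 ≠ 0) := by
  refine ⟨isMaximalLieInvarianceAlgebra_algT0 hDo hDc hDx hJo hJc,
    isMaximalLieInvarianceAlgebra_algT1 hDo hDc hDx hIo hIc hJo hJc, fun c f hf => ?_⟩
  rw [sum_sysOp_add_sysOpOf]
  exact isPurePotentialSymmetryOperator_sysField_iff hDo hDc hDx hIo hIc hJo hJc hf
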